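/- **Setting.** Let $\mathcal F_{\rm rad}=\bigoplus_{n\ge 0}\bigotimes_s^n L^2(\mathbb R^3\times\{1,2\})$ be the boson Fock space over $L^2(\mathbb R^3\times\{1,2\})$, with annihilation and creation operators $a(f),a(f)^*$ and second quantization $d\Gamma(\cdot)$. Let $\alpha_1,\alpha_2,\alpha_3,\beta$ be $4\times4$ Dirac matrices, i.e. Hermitian matrices with $\alpha_j\alpha_l+\alpha_l\alpha_j=2\delta_{jl}$, $\alpha_j\beta+\beta\alpha_j=0$, $\beta^2=1$. Let $e^{(1)},e^{(2)}:\mathbb R^3\to\mathbb R^3$ be Borel measurable polarization vectors: $e^{(\lambda)}(k)\cdot e^{(\mu)}(k)=\delta_{\lambda\mu}$ and $e^{(\lambda)}(k)\cdot k=0$ for all $k\in\mathbb R^3$. Let $\rho:\mathbb R^3\to\mathbb C$ satisfy $\rho\in L^2(\mathbb R^3)$ and $|k|^{-1}\rho\in L^2(\mathbb R^3)$, and put $$g_j(k,\lambda)=|k|^{-1/2}\rho(k)\,e^{(\lambda)}_j(k),\qquad A_j=\tfrac1{\sqrt2}\,\overline{a(g_j)+a(g_j)^*},\qquad j=1,2,3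 .$$ For $M,q\in\mathbb R$, $m\ge 0$ and $p\in\mathbb R^3$ consider on $\mathbb C^4\otimes\mathcal F_{\rm rad}$ the operator $$H_m(p)=\sum_{j}\alpha_jp_j+M\beta+d\Gamma(\omega_m)-\sum_j\alpha_j\,d\Gamma(k_j)-q\sum_j\alpha_jA_j,\qquad \omega_m(k)=(1+m)|k|+m,$$ on the intersection of the domains of its terms, where $\omega_m$ and $k_j$ stand for multiplication operators. Let $\overline{H_m(p)}$ be its closure and let $E_m(p)=\inf\sigma(\overline{H_m(p)})$ be the infimum of its spectrum, taken in the extended real line. **Proposition (spherical symmetry in the total momentum).** Assume that $|\rho|$ is rotation invariant, i.e. for every $T\in SO(3)$ one has $|\rho(Tk)|=|\rho(k)|$ for almost every $k\in\mathbb R^3$. Then, for all $M,q\in\mathbb R$ and $m\ge 0$: 1. $\overline{H_m(p)}$ is unitarily equivalent to $\overline{H_m(p')}$ for all $p,p'\in\mathbb R^3$ with $|p|=|p'|$; 2. $E_m$ is radial: $E_m(p)=E_m(p')$ whenever $|p|=|p'|$; 3. $E_m$ is non-increasing in $|p|$: $E_m(p)\ge E_m(p')$ whenever $|p|\le|p'|$.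 -/

import Mathlib

open MeasureTheory
open scoped ENNReal

noncomputable section

namespace DiracPolaron

/-! ### The one-photon space and its powers -/

/-- Momentum space `ℝ³` with the Euclidean norm. -/
abbrev R3 : Type := EuclideanSpace ℝ (Fin 3)

/-- The one-photon configuration space `ℝ³ × {1,2}` (momentum, polarization). -/
abbrev Photon : Type := R3 × Fin 2

/-- Lebesgue measure on `ℝ³` times counting measure on `{1,2}`. -/
def photonMeasure : Measure Photon := (volume : Measure R3).prod Measure.count

instance : SigmaFinite photonMeasure := by
  unfold photonMeasure; infer_instance

/-- The measure on configurations of `n` photons. -/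
def nMeasure (n : ℕ) : Measure (Fin n → Photon) := Measure.pi fun _ => photonMeasure

theorem measurePreserving_perm {n : ℕ} (σ : Equiv.Perm (Fin n)) :
    MeasurePreserving (fun x : Fin n → Photon => x ∘ σ) (nMeasure n) (nMeasure n) := by
  have h := measurePreserving_piCongrLeft (α := fun _ : Fin n => Photon)
    (fun _ => photonMeasure) σ.symm
  have e : (MeasurableEquiv.piCongrLeft (fun _ : Fin n => Photon) σ.symm : _ → _)
      = fun x : Fin n → Photon => x ∘ σ := by
    funext x i
    have := Equiv.piCongrLeft_apply_apply (fun _ : Fin n => Photon) σ.symm x (σ i)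
    rw [Equiv.symm_apply_apply] at this
    exact this
  rw [e] at h
  exact h

/-- Forgetting the `i`-th photon respects null sets. -/
theorem quasiMeasurePreserving_succAbove {n : ℕ} (i : Fin (n + 1)) :
    Measure.QuasiMeasurePreserving (fun x : Fin (n + 1) → Photon => x ∘ i.succAbove)
      (nMeasure (n + 1)) (nMeasure n) := by
  have h := measurePreserving_piFinSuccAbove (α := fun _ : Fin (n + 1) => Photon)
    (fun _ => photonMeasure) i
  exact (Measure.quasiMeasurePreserving_snd (μ := photonMeasure) (ν := nMeasure n)).comp
    h.quasiMeasurePreserving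

/-! ### The boson Fock space -/

/-- The `n`-photon space `⊗ₛⁿ L²(ℝ³ × {1,2})`, realized as the closed subspace of the
permutation symmetric elements of `L²((ℝ³ × {1,2})ⁿ)`. -/
def symmetricL2 (n : ℕ) : Submodule ℂ (Lp ℂ 2 (nMeasure n)) :=
  ⨅ σ : Equiv.Perm (Fin n),
    LinearMap.eqLocus
      (Lp.compMeasurePreservingₗ ℂ (fun x : Fin n → Photon => x ∘ σ) (measurePreserving_perm σ))
      LinearMap.id

theorem mem_symmetricL2 {n : ℕ} {f : Lp ℂ 2 (nMeasure n)} :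
    f ∈ symmetricL2 n ↔ ∀ σ : Equiv.Perm (Fin n), (fun x => f (x ∘ σ)) =ᵐ[nMeasure n] f := by
  simp only [symmetricL2, Submodule.mem_iInf, LinearMap.mem_eqLocus, LinearMap.id_apply]
  refine forall_congr' fun σ => ?_
  have h := Lp.coeFn_compMeasurePreserving f (measurePreserving_perm σ)
  constructor
  · intro hf
    refine h.symm.trans ?_
    exact Filter.EventuallyEq.of_eq (congrArg (fun g : Lp ℂ 2 (nMeasure n) => (g : _ → ℂ)) hf)
  · intro hf
    exact Lp.ext (h.trans hf)

/-- The `n`-photon Hilbert space. -/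
abbrev NPhoton (n : ℕ) : Type := symmetricL2 n

instance (n : ℕ) : CompleteSpace (NPhoton n) := by
  have hc : IsClosed (symmetricL2 n : Set (Lp ℂ 2 (nMeasure n))) := by
    simp only [symmetricL2, Submodule.coe_iInf]
    refine isClosed_iInter fun σ => ?_
    exact isClosed_eq
      (Lp.isometry_compMeasurePreserving (measurePreserving_perm σ)).continuous continuous_id
  exact hc.completeSpace_coe

/-- The boson Fock space over `L²(ℝ³ × {1,2})`: the Hilbert sum of the `n`-photon spaces. -/
abbrev Fock : Type := lp NPhoton 2

/-- The `n`-photon wave function of a Fock space vector. -/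
def wave (Ψ : Fock) (n : ℕ) : (Fin n → Photon) → ℂ := ((Ψ n : Lp ℂ 2 (nMeasure n)) : _ → ℂ)

theorem wave_add (Ψ Φ : Fock) (n : ℕ) :
    wave (Ψ + Φ) n =ᵐ[nMeasure n] fun x => wave Ψ n x + wave Φ n x :=
  Lp.coeFn_add (Ψ n : Lp ℂ 2 (nMeasure n)) (Φ n : Lp ℂ 2 (nMeasure n))

theorem wave_smul (c : ℂ) (Ψ : Fock) (n : ℕ) :
    wave (c • Ψ) n =ᵐ[nMeasure n] fun x => c * wave Ψ n x :=
  Lp.coeFn_smul c (Ψ n : Lp ℂ 2 (nMeasure n))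

theorem wave_zero (n : ℕ) : wave 0 n =ᵐ[nMeasure n] fun _ => 0 :=
  Lp.coeFn_zero ℂ 2 (nMeasure n)

theorem fock_ext {Ψ Φ : Fock} (h : ∀ n, wave Ψ n =ᵐ[nMeasure n] wave Φ n) : Ψ = Φ := by
  refine lp.ext (funext fun n => Subtype.ext (Lp.ext (h n)))

/-! ### Second quantization, creation, annihilation and field operators -/

/-- The graph of `dΓ(w)`. -/
def secondQuantGraph (w : Photon → ℝ) : Submodule ℂ (Fock × Fock) where
  carrier := {z | ∀ n, wave z.2 n =ᵐ[nMeasure n]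
    fun x => ((∑ i, w (x i) : ℝ) : ℂ) * wave z.1 n x}
  add_mem' := by
    intro a b ha hb n
    filter_upwards [ha n, hb n, wave_add a.1 b.1 n, wave_add a.2 b.2 n] with x h1 h2 h3 h4
    simp only [Prod.fst_add, Prod.snd_add, h3, h4, h1, h2]
    ring
  zero_mem' := by
    intro n
    filter_upwards [wave_zero n] with x h
    simp only [Prod.fst_zero, Prod.snd_zero, h, mul_zero]
  smul_mem' := by
    intro c a ha n
    filter_upwards [ha n, wave_smul c a.1 n, wave_smul c a.2 n] with x h1 h2 h3
    simp only [Prod.smul_fst, Prod.smul_snd, h1, h2, h3]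
    ring

/-- The second quantization `dΓ(w)` of the operator of multiplication by the real function `w`
on `L²(ℝ³ × {1,2})`: on `n`-photon functions it multiplies by `w(x₁) + ⋯ + w(xₙ)`, and its domain
consists of all `Ψ` for which the result belongs to the Fock space. -/
def secondQuant (w : Photon → ℝ) : Fock →ₗ.[ℂ] Fock := (secondQuantGraph w).toLinearPMap

theorem secondQuant_graph (w : Photon → ℝ) : (secondQuant w).graph = secondQuantGraph w := by
  refine Submodule.toLinearPMap_graph_eq _ ?_
  rintro ⟨a, b⟩ hz ha
  change a = 0 at ha
  subst ha
  refine fock_ext fun n => ?_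
  filter_upwards [hz n, wave_zero n] with x h1 h2
  exact h1.trans (by rw [h2, mul_zero])

/-- The graph of the creation operator `a(g)*`. -/
def creationGraph (g : Photon → ℂ) : Submodule ℂ (Fock × Fock) where
  carrier := {z | wave z.2 0 =ᵐ[nMeasure 0] (fun _ => 0) ∧
    ∀ n, wave z.2 (n + 1) =ᵐ[nMeasure (n + 1)] fun x =>
      ((Real.sqrt (n + 1) : ℝ) : ℂ)⁻¹ *
        ∑ i : Fin (n + 1), g (x i) * wave z.1 n (x ∘ i.succAbove)}
  add_mem' := by
    rintro a b ⟨ha0, ha⟩ ⟨hb0, hb⟩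
    constructor
    · filter_upwards [ha0, hb0, wave_add a.2 b.2 0] with x h1 h2 h3
      simp only [Prod.snd_add, h3, h1, h2, add_zero]
    · intro n
      have key : ∀ᵐ x ∂nMeasure (n + 1), ∀ i : Fin (n + 1),
          wave (a.1 + b.1) n (x ∘ i.succAbove)
            = wave a.1 n (x ∘ i.succAbove) + wave b.1 n (x ∘ i.succAbove) :=
        ae_all_iff.2 fun i => (quasiMeasurePreserving_succAbove i).ae (wave_add a.1 b.1 n)
      filter_upwards [ha n, hb n, key, wave_add a.2 b.2 (n + 1)] with x h1 h2 h3 h4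
      simp only [Prod.fst_add, Prod.snd_add, h4, h1, h2, h3, mul_add, Finset.sum_add_distrib]
  zero_mem' := by
    constructor
    · exact wave_zero 0
    · intro n
      have key : ∀ᵐ x ∂nMeasure (n + 1), ∀ i : Fin (n + 1),
          wave (0 : Fock) n (x ∘ i.succAbove) = 0 :=
        ae_all_iff.2 fun i => (quasiMeasurePreserving_succAbove i).ae (wave_zero n)
      filter_upwards [key, wave_zero (n + 1)] with x h1 h2
      simp only [Prod.fst_zero, Prod.snd_zero, h1, h2, mul_zero, Finset.sum_const_zero]
  smul_mem' := by
    rintro c a ⟨ha0, ha⟩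
    constructor
    · filter_upwards [ha0, wave_smul c a.2 0] with x h1 h2
      simp only [Prod.smul_snd, h2, h1, mul_zero]
    · intro n
      have key : ∀ᵐ x ∂nMeasure (n + 1), ∀ i : Fin (n + 1),
          wave (c • a.1) n (x ∘ i.succAbove) = c * wave a.1 n (x ∘ i.succAbove) :=
        ae_all_iff.2 fun i => (quasiMeasurePreserving_succAbove i).ae (wave_smul c a.1 n)
      filter_upwards [ha n, key, wave_smul c a.2 (n + 1)] with x h1 h2 h3
      simp only [Prod.smul_fst, Prod.smul_snd, h3, h1, h2, Finset.mul_sum]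
      exact Finset.sum_congr rfl fun i _ => by ring

/-- The (closed) creation operator `a(g)*`,
`(a(g)*Ψ)ₙ₊₁(x₀, …, xₙ) = (n + 1)^{-1/2} ∑ᵢ g(xᵢ) Ψₙ(x₀, …, x̂ᵢ, …, xₙ)`, on its maximal domain. -/
def creation (g : Photon → ℂ) : Fock →ₗ.[ℂ] Fock := (creationGraph g).toLinearPMap

theorem creation_graph (g : Photon → ℂ) : (creation g).graph = creationGraph g := by
  refine Submodule.toLinearPMap_graph_eq _ ?_
  rintro ⟨a, b⟩ ⟨hz0, hz⟩ ha
  change a = 0 at ha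
  subst ha
  refine fock_ext fun n => ?_
  cases n with
  | zero => exact hz0.trans (wave_zero 0).symm
  | succ n =>
    have key : ∀ᵐ x ∂nMeasure (n + 1), ∀ i : Fin (n + 1),
        wave (0 : Fock) n (x ∘ i.succAbove) = 0 :=
      ae_all_iff.2 fun i => (quasiMeasurePreserving_succAbove i).ae (wave_zero n)
    filter_upwards [hz n, key, wave_zero (n + 1)] with x h1 h2 h3
    refine h1.trans ?_
    simp only [h2, h3, mul_zero, Finset.sum_const_zero]

/-- The annihilation operator `a(g)`, the Hilbert space adjoint of the creation operator. -/
def annihilation (g : Photon → ℂ) : Fock →ₗ.[ℂ] Fock := (creation g).adjoint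

/-- The Segal field operator: `2^{-1/2}` times the closure of `a(g) + a(g)*`. -/
def segalField (g : Photon → ℂ) : Fock →ₗ.[ℂ] Fock :=
  (((Real.sqrt 2)⁻¹ : ℝ) : ℂ) • (annihilation g + creation g).closure

/-! ### The model -/

/-- `4 × 4` Dirac matrices: Hermitian matrices `α₁, α₂, α₃, β` with the canonical
anticommutation relations. -/
structure DiracMatrices where
  α : Fin 3 → Matrix (Fin 4) (Fin 4) ℂ
  β : Matrix (Fin 4) (Fin 4) ℂ
  α_hermitian : ∀ j, (α j).IsHermitian
  β_hermitian : β.IsHermitian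
  α_anticomm : ∀ j l, α j * α l + α l * α j = if j = l then 2 else 0
  αβ_anticomm : ∀ j, α j * β + β * α j = 0
  β_sq : β * β = 1

/-- Polarization vectors: two Borel functions `e⁽¹⁾, e⁽²⁾ : ℝ³ → ℝ³` which are orthonormal and
orthogonal to `k` at every `k`. -/
structure IsPolarization (e : Fin 2 → R3 → R3) : Prop where
  measurable : ∀ l, Measurable (e l)
  orthonormal : ∀ k, Orthonormal ℝ fun l => e l k
  orthogonal : ∀ l k, inner ℝ (e l k) k = 0

/-- The state space `ℂ⁴ ⊗ Fock`, as the Hilbert sum of four copies of the Fock space. -/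
abbrev SpinorFock : Type := PiLp 2 fun _ : Fin 4 => Fock

/-- The operator `B ⊗ 1` for a `4 × 4` matrix `B`. -/
def matOp (B : Matrix (Fin 4) (Fin 4) ℂ) : SpinorFock →ₗ[ℂ] SpinorFock where
  toFun Ψ := WithLp.toLp 2 fun s => ∑ t, B s t • Ψ t
  map_add' Ψ Φ := by
    ext1 s
    simp [smul_add, Finset.sum_add_distrib]
  map_smul' c Ψ := by
    ext1 s
    simp only [PiLp.smul_apply, RingHom.id_apply, Finset.smul_sum]
    exact Finset.sum_congr rfl fun t _ => smul_comm _ _ _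

/-- The operator `1 ⊗ T` for an operator `T` on the Fock space: `T` acts on each of the four
components, each of which has to belong to the domain of `T`. -/
def fockOp (T : Fock →ₗ.[ℂ] Fock) : SpinorFock →ₗ.[ℂ] SpinorFock where
  domain :=
    { carrier := {Ψ | ∀ s, Ψ s ∈ T.domain}
      add_mem' := fun ha hb s => T.domain.add_mem (ha s) (hb s)
      zero_mem' := fun _ => T.domain.zero_mem
      smul_mem' := fun c _ ha s => T.domain.smul_mem c (ha s) }
  toFun :=
    { toFun := fun Ψ => WithLp.toLp 2 fun s => T ⟨(Ψ : SpinorFock) s, Ψ.2 s⟩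
      map_add' := fun Ψ Φ => by
        ext1 s
        exact T.map_add ⟨(Ψ : SpinorFock) s, Ψ.2 s⟩ ⟨(Φ : SpinorFock) s, Φ.2 s⟩
      map_smul' := fun c Ψ => by
        ext1 s
        exact T.map_smul c ⟨(Ψ : SpinorFock) s, Ψ.2 s⟩ }

/-- The coupling function `g_j(k, λ) = |k|^{-1/2} ρ(k) e_j^{(λ)}(k)` at the point `x = 0`. -/
def coupling (ρ : R3 → ℂ) (e : Fin 2 → R3 → R3) (j : Fin 3) : Photon → ℂ :=
  fun x => (((Real.sqrt ‖x.1‖)⁻¹ : ℝ) : ℂ) * ρ x.1 * ((e x.2 x.1 j : ℝ) : ℂ)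

/-- The regularized Dirac polaron Hamiltonian
`H_m(p) = α·p + Mβ + dΓ(ω_m) - α·dΓ(k) - q α·A`, `ω_m(k) = (1 + m)|k| + m`,
on the intersection of the domains of its terms. -/
def hamiltonian (D : DiracMatrices) (e : Fin 2 → R3 → R3) (ρ : R3 → ℂ) (M q m : ℝ) (p : R3) :
    SpinorFock →ₗ.[ℂ] SpinorFock :=
  (matOp ((∑ j, (p j : ℂ) • D.α j) + (M : ℂ) • D.β)).toPMap ⊤
    + fockOp (secondQuant fun x => (1 + m) * ‖x.1‖ + m)
    - (∑ j, (matOp (D.α j)).compPMap (fockOp (secondQuant fun x => x.1 j)))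
    - (q : ℂ) • (∑ j, (matOp (D.α j)).compPMap (fockOp (segalField (coupling ρ e j))))

/-! ### Spectrum and unitary equivalence of unbounded operators -/

/-- `z` is in the resolvent set of `T`: `T - z` maps its domain bijectively onto the whole space,
with bounded inverse `R`. -/
def InResolventSet {E : Type*} [NormedAddCommGroup E] [NormedSpace ℂ E]
    (T : E →ₗ.[ℂ] E) (z : ℂ) : Prop :=
  ∃ R : E →L[ℂ] E,
    (∀ y : E, ∃ h : R y ∈ T.domain, T ⟨R y, h⟩ - z • R y = y) ∧
    (∀ x : T.domain, R (T x - z • (x : E)) = x)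

/-- The spectrum of a (possibly unbounded) operator. -/
def opSpectrum {E : Type*} [NormedAddCommGroup E] [NormedSpace ℂ E]
    (T : E →ₗ.[ℂ] E) : Set ℂ :=
  {z | ¬ InResolventSet T z}

/-- `S = U T U⁻¹`, including equality of the domains, for some unitary operator `U`. -/
def UnitarilyEquivalent {E : Type*} [NormedAddCommGroup E] [InnerProductSpace ℂ E]
    (T S : E →ₗ.[ℂ] E) : Prop :=
  ∃ U : E ≃ₗᵢ[ℂ] E, ∀ x y : E, (x, y) ∈ T.graph ↔ (U x, U y) ∈ S.graph

/-- The lowest energy `E_m(p)`: the infimum, taken in the extended reals, of the spectrum of the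
closure of `H_m(p)`. -/
def lowestEnergy (D : DiracMatrices) (e : Fin 2 → R3 → R3) (ρ : R3 → ℂ) (M q m : ℝ) (p : R3) :
    EReal :=
  sInf ((fun t : ℝ => (t : EReal)) ''
    {t : ℝ | (t : ℂ) ∈ opSpectrum (hamiltonian D e ρ M q m p).closure})

/-- Rotation invariance, almost everywhere: `f(Tk) = f(k)` for every `T ∈ SO(3)`. -/
def RotationInvariant (f : R3 → ℝ) : Prop :=
  ∀ T : R3 ≃ₗᵢ[ℝ] R3, LinearMap.det (T.toLinearEquiv : R3 →ₗ[ℝ] R3) = 1 →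
    ∀ᵐ k, f (T k) = f k

end DiracPolaron

end

noncomputable section

namespace DiracPolaron

/-! ### Graphs, closures and resolvents of unbounded operators -/

section Operators

variable {E : Type*} [NormedAddCommGroup E] [InnerProductSpace ℂ E]

/-! Two facts carry the proof: the Hamiltonian is rotation covariant, and it is affine in `p` with a
bounded coefficient.

Covariance. Vectors of equal length are exchanged by a half-turn `T` (`exists_halfTurnMap`), so no
lift of the whole rotation group to spinors is needed: `(α·v) α₁α₂α₃` implements the half-turn about
`v` and commutes with `β` (`α_mul_halfTurn`, `halfTurn_mul_β`). On photons `T` acts by `k ↦ Tk`,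
with a unitary `2 × 2` matrix correcting the mismatch between the rotated polarization frame at `k`
and the frame at `Tk`, times a phase, because only `|ρ|` is invariant (`exists_photonRotation`).
Then `dΓ(k)` and `A` transform as vectors and their contractions with `α` are preserved, which gives
`hamiltonian_unitarilyEquivalent`. Equivalence passes to the closures, and equality of spectra
follows.

Monotonicity. If `|p| ≤ |p'|`, then `p` is a convex combination of `u` and `-u` with `|u| = |p'|`.
If every real number below `c` is a resolvent point at `p'`, the same holds at `u` and `-u`, and
both quadratic forms are at least `c` (`le_re_inner_of_forall_inResolventSet`). The form is affine
in the momentum, so the bound holds at `p` too. A lower form bound does not by itself give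
surjectivity of `H - t`. That is obtained by bounded perturbation from `u`, first far below `c` and
then moving up to `t` (`inResolventSet_of_perturbation`). Only symmetry is used: self-adjointness of
the closure is never established, and the value `-∞` needs no separate treatment.

The analytic input is that the domain of `dΓ(ω_m)` lies in the domains of all other terms. For the
fields this rests on estimates of creation and annihilation operators by `dΓ(ω_m)`. -/

/-- The homeomorphism `(x, y) ↦ (U x, U y + C x)` of the graph space. -/
def graphHomeomorph (U : E ≃L[ℂ] E) (C : E →L[ℂ] E) : E × E ≃ₜ E × E where
  toFun z := (U z.1, U z.2 + C z.1)
  invFun z := (U.symm z.1, U.symm (z.2 - C (U.symm z.1)))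
  left_inv z := by simp
  right_inv z := by simp
  continuous_toFun := by fun_prop
  continuous_invFun := by fun_prop

/-- One graph is the preimage of the other under a homeomorphism, so the same is true of their
closures. The map sends `(0, y)` to `(0, U y)`, so single-valuedness pulls back. -/
theorem isClosable_of_graph_iff {T S : E →ₗ.[ℂ] E} (U : E ≃L[ℂ] E) (C : E →L[ℂ] E)
    (h : ∀ x y, (x, y) ∈ T.graph ↔ (U x, U y + C x) ∈ S.graph) (hS : S.IsClosable) :
    T.IsClosable ∧ ∀ x y, (x, y) ∈ T.closure.graph ↔ (U x, U y + C x) ∈ S.closure.graph := by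
  have hpre : (T.graph : Set (E × E)) = graphHomeomorph U C ⁻¹' (S.graph : Set (E × E)) := by
    ext ⟨x, y⟩
    exact h x y
  have hcl : ∀ x y, (x, y) ∈ T.graph.topologicalClosure ↔
      (U x, U y + C x) ∈ S.closure.graph := by
    intro x y
    rw [← hS.graph_closure_eq_closure_graph, ← SetLike.mem_coe, ← SetLike.mem_coe,
      Submodule.topologicalClosure_coe, Submodule.topologicalClosure_coe, hpre,
      ← (graphHomeomorph U C).preimage_closure]
    rfl
  have hT : T.IsClosable := by
    refine ⟨T.graph.topologicalClosure.toLinearPMap, ?_⟩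
    rw [Submodule.toLinearPMap_graph_eq]
    rintro ⟨x, y⟩ hxy hx
    change x = 0 at hx
    subst hx
    rw [hcl] at hxy
    have := LinearPMap.graph_fst_eq_zero_snd _ hxy (map_zero U)
    simpa using this
  refine ⟨hT, fun x y => ?_⟩
  rw [← hcl, hT.graph_closure_eq_closure_graph]

/-- A bounded triangular transformation of graphs carries over to the closures. -/
theorem closure_graph_iff_of_graph_iff {T S : E →ₗ.[ℂ] E} (U : E ≃L[ℂ] E) (C : E →L[ℂ] E)
    (h : ∀ x y, (x, y) ∈ T.graph ↔ (U x, U y + C x) ∈ S.graph) (x y : E) :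
    (x, y) ∈ T.closure.graph ↔ (U x, U y + C x) ∈ S.closure.graph := by
  by_cases hS : S.IsClosable
  · exact (isClosable_of_graph_iff U C h hS).2 x y
  -- The closure of a non-closable operator is by convention the operator itself. The inverse
  -- transformation, with lower entry `-U⁻¹ C U⁻¹`, shows that both operators are non-closable
  -- together.
  · have hT : ¬ T.IsClosable := by
      intro hT
      refine hS (isClosable_of_graph_iff (T := S) (S := T) U.symm
        (-((U.symm : E →L[ℂ] E).comp (C.comp (U.symm : E →L[ℂ] E)))) (fun x y => ?_) hT).1
      rw [h]
      simp
    rw [LinearPMap.closure_def' hS, LinearPMap.closure_def' hT]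
    exact h x y

theorem UnitarilyEquivalent.closure {T S : E →ₗ.[ℂ] E} (h : UnitarilyEquivalent T S) :
    UnitarilyEquivalent T.closure S.closure := by
  obtain ⟨U, hU⟩ := h
  refine ⟨U, fun x y => ?_⟩
  simpa using closure_graph_iff_of_graph_iff U.toContinuousLinearEquiv 0
    (by simpa using hU) x y

/-- An operator is symmetric if `⟪T x, x'⟫ = ⟪x, T x'⟫` on its domain. -/
def IsSymmetricOp (T : E →ₗ.[ℂ] E) : Prop :=
  ∀ x y x' y', (x, y) ∈ T.graph → (x', y') ∈ T.graph → inner ℂ y x' = inner ℂ x y'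

/-- The identity is a closed condition on pairs of graph points, and the closure of a product is the
product of the closures. -/
theorem IsSymmetricOp.closure {T : E →ₗ.[ℂ] E} (hT : IsSymmetricOp T) :
    IsSymmetricOp T.closure := by
  by_cases hc : T.IsClosable
  swap
  · rwa [LinearPMap.closure_def' hc]
  have hcl : ∀ z, z ∈ T.closure.graph ↔ z ∈ _root_.closure (T.graph : Set (E × E)) := by
    intro z
    rw [← hc.graph_closure_eq_closure_graph, ← SetLike.mem_coe,
      Submodule.topologicalClosure_coe]
  have key : ∀ z ∈ _root_.closure (T.graph : Set (E × E)) ×ˢ _root_.closure (T.graph : Set (E × E)),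
      inner ℂ z.1.2 z.2.1 = inner ℂ z.1.1 z.2.2 := by
    rw [← closure_prod_eq]
    intro z hz
    refine closure_minimal (s := (T.graph : Set (E × E)) ×ˢ (T.graph : Set (E × E)))
      (t := {z : (E × E) × (E × E) | inner ℂ z.1.2 z.2.1 = inner ℂ z.1.1 z.2.2}) ?_ ?_ hz
    · rintro ⟨⟨x, y⟩, ⟨x', y'⟩⟩ ⟨h1, h2⟩
      exact hT x y x' y' h1 h2
    · exact isClosed_eq (by fun_prop) (by fun_prop)
  intro x y x' y' h1 h2
  exact key ((x, y), (x', y')) ⟨(hcl _).1 h1, (hcl _).1 h2⟩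

/-- `R` is the resolvent of `T` at `z`. -/
def IsResolvent (T : E →ₗ.[ℂ] E) (z : ℂ) (R : E →L[ℂ] E) : Prop :=
  (∀ y, (R y, y + z • R y) ∈ T.graph) ∧ ∀ x y, (x, y) ∈ T.graph → R (y - z • x) = x

theorem inResolventSet_iff {T : E →ₗ.[ℂ] E} {z : ℂ} :
    InResolventSet T z ↔ ∃ R, IsResolvent T z R := by
  refine exists_congr fun R => and_congr (forall_congr' fun y => ?_) ⟨?_, ?_⟩
  · constructor
    · rintro ⟨h, h'⟩
      rw [LinearPMap.mem_graph_iff]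
      exact ⟨⟨R y, h⟩, rfl, by rw [← sub_eq_iff_eq_add]; exact h'⟩
    · intro h
      obtain ⟨⟨x, hx⟩, h1, h2⟩ := (LinearPMap.mem_graph_iff _).1 h
      dsimp only at h1 h2
      subst h1
      exact ⟨hx, by rw [h2]; simp⟩
  · intro h x y hxy
    obtain ⟨⟨x', hx⟩, h1, h2⟩ := (LinearPMap.mem_graph_iff _).1 hxy
    dsimp only at h1 h2
    subst h1 h2
    exact h ⟨x', hx⟩
  · intro h x
    exact h _ _ (LinearPMap.mem_graph _ x)

theorem UnitarilyEquivalent.inResolventSet {T S : E →ₗ.[ℂ] E} (h : UnitarilyEquivalent T S)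
    {z : ℂ} (hz : InResolventSet T z) : InResolventSet S z := by
  obtain ⟨U, hU⟩ := h
  obtain ⟨R, h1, h2⟩ := inResolventSet_iff.1 hz
  refine inResolventSet_iff.2 ⟨(U.toContinuousLinearEquiv : E →L[ℂ] E).comp
    (R.comp (U.symm.toContinuousLinearEquiv : E →L[ℂ] E)), fun y => ?_, fun x y hxy => ?_⟩
  · have := (hU _ _).1 (h1 (U.symm y))
    simpa using this
  · have h3 := (hU (U.symm x) (U.symm y)).2 (by simpa using hxy)
    have := h2 _ _ h3
    rw [← map_smul, ← map_sub] at this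
    change U (R (U.symm (y - z • x))) = x
    rw [this, U.apply_symm_apply]

theorem UnitarilyEquivalent.symm {T S : E →ₗ.[ℂ] E} (h : UnitarilyEquivalent T S) :
    UnitarilyEquivalent S T := by
  obtain ⟨U, hU⟩ := h
  exact ⟨U.symm, fun x y => by rw [hU]; simp⟩

theorem UnitarilyEquivalent.opSpectrum_eq {T S : E →ₗ.[ℂ] E} (h : UnitarilyEquivalent T S) :
    opSpectrum T = opSpectrum S := by
  ext z
  exact not_congr ⟨h.inResolventSet, h.symm.inResolventSet⟩

/-- First resolvent identity, from applying `R` to `(T - z) R' y = y + (z' - z) R' y`. -/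
theorem IsResolvent.sub_eq {T : E →ₗ.[ℂ] E} {z z' : ℂ} {R R' : E →L[ℂ] E}
    (h : IsResolvent T z R) (h' : IsResolvent T z' R') (y : E) :
    R (R' y) = (z - z')⁻¹ • (R y - R' y) ∨ z = z' := by
  by_cases hz : z = z'
  · exact Or.inr hz
  left
  have h1 := h.2 _ _ (h'.1 y)
  have h2 : R y - (z - z') • R (R' y) = R' y := by
    rw [map_sub, map_add, map_smul, map_smul] at h1
    nth_rewrite 2 [← h1]
    module
  have h3 : R y - R' y = (z - z') • R (R' y) := by
    rw [sub_eq_iff_eq_add, add_comm, ← sub_eq_iff_eq_add]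
    exact h2
  rw [h3, inv_smul_smul₀ (sub_ne_zero.2 hz)]

variable [CompleteSpace E]

theorem IsResolvent.isSelfAdjoint {T : E →ₗ.[ℂ] E} (hT : IsSymmetricOp T) {t : ℝ}
    {R : E →L[ℂ] E} (h : IsResolvent T t R) : IsSelfAdjoint R := by
  rw [ContinuousLinearMap.isSelfAdjoint_iff_isSymmetric]
  intro x y
  have := hT _ _ _ _ (h.1 x) (h.1 y)
  rw [inner_add_left, inner_add_right, inner_smul_left, inner_smul_right, Complex.conj_ofReal] at this
  exact (add_right_cancel this).symm

/-- A substitute for the spectral theorem. At real `t < c` the resolvent `R` is a bounded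
self-adjoint operator. A negative spectral value `μ` of `R` would correspond to the point `t + 1/μ <
c` for `T`, which is a resolvent point. Hence `R ≥ 0`, which says that `T ≥ t` as a form; finally
`t` tends to `c`. -/
theorem le_re_inner_of_forall_inResolventSet {T : E →ₗ.[ℂ] E} (hT : IsSymmetricOp T) {c : ℝ}
    (hc : ∀ t : ℝ, t < c → InResolventSet T t) {x y : E} (hxy : (x, y) ∈ T.graph) :
    c * ‖x‖ ^ 2 ≤ (inner ℂ x y).re := by
  have key : ∀ t : ℝ, t < c → t * ‖x‖ ^ 2 ≤ (inner ℂ x y).re := by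
    intro t ht
    obtain ⟨R, hR⟩ := inResolventSet_iff.1 (hc t ht)
    have hsa := hR.isSelfAdjoint hT
    have hpos : 0 ≤ R := by
      refine (StarOrderedRing.nonneg_iff_spectrum_nonneg (R := ℝ) R).2 fun μ hμ => ?_
      by_contra! hneg
      refine hμ ?_
      have hμ0 : (μ : ℂ) ≠ 0 := by exact_mod_cast hneg.ne
      have hlt : t + μ⁻¹ < c := by linarith [inv_lt_zero.2 hneg]
      obtain ⟨R', hR'⟩ := inResolventSet_iff.1 (hc _ hlt)
      have e1 : (t : ℂ) - ((t + μ⁻¹ : ℝ) : ℂ) = -(μ : ℂ)⁻¹ := by push_cast; ring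
      have e2 : ((t + μ⁻¹ : ℝ) : ℂ) - (t : ℂ) = (μ : ℂ)⁻¹ := by push_cast; ring
      have hne : (t : ℂ) ≠ ((t + μ⁻¹ : ℝ) : ℂ) := by
        rw [← sub_ne_zero, e1]; simpa using hμ0
      have h1 : ∀ y, R (R' y) = -(μ : ℂ) • (R y - R' y) := fun y => by
        have := (hR.sub_eq hR' y).resolve_right hne
        rwa [e1, inv_neg, inv_inv] at this
      have h2 : ∀ y, R' (R y) = (μ : ℂ) • (R' y - R y) := fun y => by
        have := (hR'.sub_eq hR y).resolve_right hne.symm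
        rwa [e2, inv_inv] at this
      have eR : (algebraMap ℝ (E →L[ℂ] E)) μ = (μ : ℂ) • (1 : E →L[ℂ] E) := by
        rw [Algebra.algebraMap_eq_smul_one, Complex.coe_smul]
      rw [spectrum.mem_resolventSet_iff, eR]
      -- Formally `μ - R = μ (T - t - 1/μ) R`, whose inverse is `μ⁻¹ (T - t) R' = μ⁻¹ (1 + μ⁻¹ R')`.
      refine isUnit_iff_exists.2 ⟨(μ : ℂ)⁻¹ • (1 + (μ : ℂ)⁻¹ • R'), ?_, ?_⟩
      · ext y
        simp only [mul_apply_eq_comp, sub_apply,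
          smul_apply, add_apply,
          one_apply_eq_self, map_smul, map_add, h1]
        match_scalars <;> field_simp <;> ring
      · ext y
        simp only [mul_apply_eq_comp, sub_apply,
          smul_apply, add_apply,
          one_apply_eq_self, map_smul, map_sub, h2]
        match_scalars <;> field_simp <;> ring
    have h3 := ((ContinuousLinearMap.nonneg_iff_isPositive R).1 hpos).re_inner_nonneg_left
      (y - (t : ℂ) • x)
    rw [hR.2 x y hxy, inner_sub_right, inner_smul_right, inner_self_eq_norm_sq_to_K] at h3
    have : RCLike.re (inner ℂ x y - (t : ℂ) * ((‖x‖ : ℝ) : ℂ) ^ 2) = (inner ℂ x y).re - t * ‖x‖ ^ 2 := by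
      norm_cast
    erw [this] at h3
    linarith
  refine le_of_tendsto (f := fun t : ℝ => t * ‖x‖ ^ 2) (x := nhdsWithin c (Set.Iio c)) ?_
    (eventually_mem_nhdsWithin.mono key)
  exact (Continuous.tendsto (by fun_prop) c).mono_left nhdsWithin_le_nhds

omit [CompleteSpace E] in
-- The form bound at `R y` reads `(c - s) ‖R y‖² ≤ Re ⟪R y, y⟫`; Cauchy–Schwarz does the rest.
theorem IsResolvent.norm_le {T : E →ₗ.[ℂ] E} {c s : ℝ} (hs : s < c)
    (hc : ∀ x y, (x, y) ∈ T.graph → c * ‖x‖ ^ 2 ≤ (inner ℂ x y).re)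
    {R : E →L[ℂ] E} (hR : IsResolvent T s R) : ‖R‖ ≤ (c - s)⁻¹ := by
  have hcs : 0 < c - s := sub_pos.2 hs
  refine ContinuousLinearMap.opNorm_le_bound _ (inv_nonneg.2 hcs.le) fun y => ?_
  have h1 := hc _ _ (hR.1 y)
  rw [inner_add_right, inner_smul_right, inner_self_eq_norm_sq_to_K] at h1
  have e : (inner ℂ (R y) y + (s : ℂ) * ((‖R y‖ : ℝ) : ℂ) ^ 2).re
      = (inner ℂ (R y) y).re + s * ‖R y‖ ^ 2 := by
    norm_cast
  erw [e] at h1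
  have h2 : (inner ℂ (R y) y).re ≤ ‖R y‖ * ‖y‖ :=
    (Complex.re_le_norm _).trans (norm_inner_le_norm _ _)
  rw [inv_mul_eq_div, le_div_iff₀ hcs]
  rcases (norm_nonneg (R y)).eq_or_lt with h0 | h0
  · rw [← h0, zero_mul]; exact norm_nonneg _
  · refine le_of_mul_le_mul_left ?_ h0
    nlinarith

/-- Stability of the resolvent set under small bounded perturbations. -/
theorem IsResolvent.perturb {T S : E →ₗ.[ℂ] E} {z z' : ℂ} {R : E →L[ℂ] E}
    (hR : IsResolvent T z R) (B : E →L[ℂ] E) (hB : ‖B‖ * ‖R‖ < 1)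
    (h : ∀ x y, (x, y) ∈ T.graph ↔ (x, y + B x + (z' - z) • x) ∈ S.graph) :
    InResolventSet S z' := by
  -- On the common domain `S - z' = (1 + B R)(T - z)`, so the resolvent of `S` is `R (1 + B R)⁻¹`, a
  -- Neumann series. The shift `z' - z` lets the statement also cover a change of spectral point.
  have hsmall : ‖-(B.comp R)‖ < 1 := by
    rw [norm_neg]
    exact (B.opNorm_comp_le R).trans_lt hB
  obtain ⟨u, hu⟩ := isUnit_one_sub_of_norm_lt_one hsmall
  have hu1 : ∀ v, (u⁻¹ : (E →L[ℂ] E)ˣ).1 (v + B (R v)) = v := fun v => by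
    have := congrArg (fun A : E →L[ℂ] E => A v) u.inv_mul
    simpa [hu] using this
  have hu2 : ∀ v, (u⁻¹ : (E →L[ℂ] E)ˣ).1 v + B (R ((u⁻¹ : (E →L[ℂ] E)ˣ).1 v)) = v := fun v => by
    have := congrArg (fun A : E →L[ℂ] E => A v) u.mul_inv
    simpa [hu] using this
  refine inResolventSet_iff.2 ⟨R.comp (u⁻¹ : (E →L[ℂ] E)ˣ).1, fun y => ?_, fun x y hxy => ?_⟩
  · have h1 := (h _ _).1 (hR.1 ((u⁻¹ : (E →L[ℂ] E)ˣ).1 y))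
    have e : ∀ r : E, (u⁻¹ : (E →L[ℂ] E)ˣ).1 y + z • r + B (R ((u⁻¹ : (E →L[ℂ] E)ˣ).1 y))
        + (z' - z) • r = y + z' • r := by
      intro r
      nth_rewrite 3 [← hu2 y]
      module
    rw [e] at h1
    exact h1
  · have h1 : (x, y - B x - (z' - z) • x) ∈ T.graph := by
      rw [h]
      convert hxy using 2
      abel
    have h2 := hR.2 _ _ h1
    set v := y - B x - (z' - z) • x - z • x with hv
    have e : y - z' • x = v + B (R v) := by
      rw [h2, hv]
      module
    rw [ContinuousLinearMap.comp_apply, e, hu1, h2]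

/-- If `T` is symmetric, every real number below `c` is a resolvent point of `T`, and the
bounded perturbation `S = T + B` is bounded below by `c`, then every real number below `c` is a
resolvent point of `S`. -/
theorem inResolventSet_of_perturbation {T S : E →ₗ.[ℂ] E} (hT : IsSymmetricOp T) {c : ℝ}
    (hc : ∀ t : ℝ, t < c → InResolventSet T t) (B : E →L[ℂ] E)
    (h : ∀ x y, (x, y) ∈ T.graph ↔ (x, y + B x) ∈ S.graph)
    (hS : ∀ x y, (x, y) ∈ S.graph → c * ‖x‖ ^ 2 ≤ (inner ℂ x y).re) {t : ℝ} (ht : t < c) :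
    InResolventSet S t := by
  -- So far below `c` that `‖B‖ (c - s)⁻¹ < 1`, which makes `B` a small perturbation at `s`.
  set s : ℝ := min t (c - ‖B‖ - 1) with hs
  have hst : s ≤ t := min_le_left _ _
  have hsB : ‖B‖ < c - s := by linarith [min_le_right t (c - ‖B‖ - 1)]
  have hsc : s < c := hst.trans_lt ht
  have hcs : 0 < c - s := sub_pos.2 hsc
  obtain ⟨R, hR⟩ := inResolventSet_iff.1 (hc s hsc)
  have hRn := hR.norm_le hsc fun x y => le_re_inner_of_forall_inResolventSet hT hc
  have h1 : InResolventSet S (s : ℂ) := by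
    refine hR.perturb B ?_ fun x y => ?_
    · calc ‖B‖ * ‖R‖ ≤ ‖B‖ * (c - s)⁻¹ := by gcongr
        _ < 1 := by rwa [← div_eq_mul_inv, div_lt_one hcs]
    · rw [h]
      simp
  obtain ⟨R', hR'⟩ := inResolventSet_iff.1 h1
  have hRn' := hR'.norm_le hsc hS
  -- Now the operator stays fixed and the spectral point moves from `s` to `t`. The form bound on
  -- `S` gives `‖R'‖ ≤ (c - s)⁻¹`, and `(t - s)/(c - s) < 1`, so one step suffices.
  refine hR'.perturb (((s : ℂ) - t) • ContinuousLinearMap.id ℂ E) ?_ fun x y => ?_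
  · have hn : ‖((s : ℂ) - t) • ContinuousLinearMap.id ℂ E‖ ≤ t - s := by
      rw [norm_smul]
      have e1 : ‖(s : ℂ) - t‖ = t - s := by
        rw [← Complex.ofReal_sub, Complex.norm_real, Real.norm_eq_abs, abs_sub_comm,
          abs_of_nonneg (sub_nonneg.2 hst)]
      rw [e1]
      exact mul_le_of_le_one_right (sub_nonneg.2 hst) ContinuousLinearMap.norm_id_le
    calc _ ≤ (t - s) * (c - s)⁻¹ := by
          gcongr
      _ < 1 := by
          rw [← div_eq_mul_inv, div_lt_one hcs]
          linarith
  · have e : y + (((s : ℂ) - t) • ContinuousLinearMap.id ℂ E) x + ((t : ℂ) - s) • x = y := by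
      simp only [smul_apply, ContinuousLinearMap.id_apply]
      module
    rw [e]

end Operators

/-! ### Wave functions -/

section Waves

instance (n : ℕ) : SigmaFinite (nMeasure n) := by
  unfold nMeasure; infer_instance

theorem stronglyMeasurable_wave (Ψ : Fock) (n : ℕ) : StronglyMeasurable (wave Ψ n) :=
  Lp.stronglyMeasurable _

theorem wave_comp_perm (Ψ : Fock) {n : ℕ} (σ : Equiv.Perm (Fin n)) :
    (fun x => wave Ψ n (x ∘ σ)) =ᵐ[nMeasure n] wave Ψ n :=
  mem_symmetricL2.1 (Ψ n).2 σ

theorem enorm_sq_Lp {n : ℕ} (f : Lp ℂ 2 (nMeasure n)) :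
    ‖f‖ₑ ^ 2 = ∫⁻ x, ‖f x‖ₑ ^ 2 ∂nMeasure n := by
  have h := eLpNorm_nnreal_pow_eq_lintegral (f := f) (μ := nMeasure n) (p := 2) two_ne_zero
  rw [Lp.enorm_def]
  simpa using h

/-- Norms are taken in `ℝ≥0∞` so that estimates can be summed over the photon number before
finiteness is known. -/
theorem enorm_sq_eq_tsum (Ψ : Fock) :
    ‖Ψ‖ₑ ^ 2 = ∑' n, ∫⁻ x, ‖wave Ψ n x‖ₑ ^ 2 ∂nMeasure n := by
  have h := lp.norm_rpow_eq_tsum (p := 2) (by norm_num) Ψ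
  have hs := (lp.memℓp Ψ).summable (by norm_num)
  simp only [ENNReal.toReal_ofNat, Real.rpow_ofNat] at h hs
  rw [← ofReal_norm, ← ENNReal.ofReal_pow (norm_nonneg _), h,
    ENNReal.ofReal_tsum_of_nonneg (fun n => by positivity) hs]
  refine tsum_congr fun n => ?_
  rw [ENNReal.ofReal_pow (norm_nonneg _), ofReal_norm]
  exact enorm_sq_Lp (Ψ n : Lp ℂ 2 (nMeasure n))

/-- Square summable families of permutation symmetric functions are wave functions. -/
theorem exists_wave_ae_eq (F : ∀ n, (Fin n → Photon) → ℂ)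
    (hm : ∀ n, AEStronglyMeasurable (F n) (nMeasure n))
    (hs : ∀ n (σ : Equiv.Perm (Fin n)), (fun x => F n (x ∘ σ)) =ᵐ[nMeasure n] F n)
    (hF : ∑' n, ∫⁻ x, ‖F n x‖ₑ ^ 2 ∂nMeasure n ≠ ∞) :
    ∃ Ψ : Fock, ∀ n, wave Ψ n =ᵐ[nMeasure n] F n := by
  have hL : ∀ n, MemLp (F n) 2 (nMeasure n) := by
    intro n
    refine ⟨hm n, ?_⟩
    have h := eLpNorm_nnreal_pow_eq_lintegral (f := F n) (μ := nMeasure n) (p := 2) two_ne_zero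
    have h' : eLpNorm (F n) 2 (nMeasure n) ^ 2 = ∫⁻ x, ‖F n x‖ₑ ^ 2 ∂nMeasure n := by
      simpa using h
    have hn : ∫⁻ x, ‖F n x‖ₑ ^ 2 ∂nMeasure n ≠ ∞ := ENNReal.ne_top_of_tsum_ne_top hF n
    rw [← h'] at hn
    exact lt_top_iff_ne_top.2 fun h => hn (by simp [h])
  let f : ∀ n, NPhoton n := fun n => ⟨(hL n).toLp (F n), by
    rw [mem_symmetricL2]
    intro σ
    have h1 := (hL n).coeFn_toLp
    exact ((measurePreserving_perm σ).quasiMeasurePreserving.ae_eq_comp h1).trans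
      ((hs n σ).trans h1.symm)⟩
  have hf : ∀ n, ((f n : Lp ℂ 2 (nMeasure n)) : _ → ℂ) =ᵐ[nMeasure n] F n :=
    fun n => (hL n).coeFn_toLp
  have hn : ∀ n, ENNReal.ofReal (‖f n‖ ^ 2) = ∫⁻ x, ‖F n x‖ₑ ^ 2 ∂nMeasure n := by
    intro n
    rw [ENNReal.ofReal_pow (norm_nonneg _), ofReal_norm]
    refine (enorm_sq_Lp (f n : Lp ℂ 2 (nMeasure n))).trans (lintegral_congr_ae ?_)
    filter_upwards [hf n] with x hx
    rw [hx]
  have hmem : Memℓp f 2 := by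
    refine memℓp_gen ?_
    simp only [ENNReal.toReal_ofNat, Real.rpow_ofNat]
    have := ENNReal.summable_toReal (f := fun n => ENNReal.ofReal (‖f n‖ ^ 2))
      (by simpa only [hn] using hF)
    refine this.congr fun n => ?_
    rw [ENNReal.toReal_ofReal (by positivity)]
  exact ⟨⟨f, hmem⟩, hf⟩

theorem hasSum_inner_wave (Ψ Φ : Fock) :
    HasSum (fun n => ∫ x, inner ℂ (wave Ψ n x) (wave Φ n x) ∂nMeasure n) (inner ℂ Ψ Φ) :=
  lp.hasSum_inner Ψ Φ

theorem integrable_inner_wave (Ψ Φ : Fock) (n : ℕ) :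
    Integrable (fun x => inner ℂ (wave Ψ n x) (wave Φ n x)) (nMeasure n) :=
  L2.integrable_inner (𝕜 := ℂ) (Ψ n : Lp ℂ 2 (nMeasure n)) (Φ n : Lp ℂ 2 (nMeasure n))

theorem enorm_inner_le_tsum (Ψ Φ : Fock) :
    ‖inner ℂ Ψ Φ‖ₑ ≤ ∑' n, ∫⁻ x, ‖wave Ψ n x‖ₑ * ‖wave Φ n x‖ₑ ∂nMeasure n := by
  rw [← (hasSum_inner_wave Ψ Φ).tsum_eq]
  refine (enorm_tsum_le_tsum_enorm).trans (ENNReal.tsum_le_tsum fun n => ?_)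
  refine (enorm_integral_le_lintegral_enorm _).trans (lintegral_mono fun x => ?_)
  rw [← enorm_mul]
  refine (le_of_eq ?_)
  rw [← ofReal_norm, ← ofReal_norm]
  simp [mul_comm]

theorem lintegral_succAbove {n : ℕ} (i : Fin (n + 1)) {F : Photon → ℝ≥0∞}
    {G : (Fin n → Photon) → ℝ≥0∞} (hF : AEMeasurable F photonMeasure)
    (hG : AEMeasurable G (nMeasure n)) :
    ∫⁻ x, F (x i) * G (x ∘ i.succAbove) ∂nMeasure (n + 1)
      = (∫⁻ y, F y ∂photonMeasure) * ∫⁻ x, G x ∂nMeasure n := by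
  have h := measurePreserving_piFinSuccAbove (α := fun _ : Fin (n + 1) => Photon)
    (fun _ => photonMeasure) i
  rw [← lintegral_prod_mul hF hG]
  refine Eq.trans ?_ (h.lintegral_comp_emb (MeasurableEquiv.measurableEmbedding _) _)
  rfl

theorem quasiMeasurePreserving_apply {n : ℕ} (i : Fin n) :
    Measure.QuasiMeasurePreserving (fun x : Fin n → Photon => x i) (nMeasure n) photonMeasure :=
  Measure.quasiMeasurePreserving_eval _ i

/-- Removing a variable before or after a permutation gives the same up to a permutation. -/
theorem exists_perm_succAbove {n : ℕ} (σ : Equiv.Perm (Fin (n + 1))) (i : Fin (n + 1)) :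
    ∃ τ : Equiv.Perm (Fin n), σ ∘ i.succAbove = (σ i).succAbove ∘ τ := by
  have h : ∀ j : Fin n, σ (i.succAbove j) ≠ σ i := fun j hj =>
    i.succAbove_ne j (σ.injective hj)
  choose τ hτ using fun j => Fin.exists_succAbove_eq (h j)
  have hinj : Function.Injective τ := by
    intro a b hab
    have := hτ a
    rw [hab, hτ b] at this
    exact Fin.succAbove_right_injective (σ.injective this.symm)
  exact ⟨Equiv.ofBijective τ (Finite.injective_iff_bijective.1 hinj),
    funext fun j => (hτ j).symm⟩

theorem wave_succAbove_comp_perm (Ψ : Fock) {n : ℕ} (σ : Equiv.Perm (Fin (n + 1)))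
    (i : Fin (n + 1)) :
    ∀ᵐ x ∂nMeasure (n + 1),
      wave Ψ n ((x ∘ σ) ∘ i.succAbove) = wave Ψ n (x ∘ (σ i).succAbove) := by
  obtain ⟨τ, hτ⟩ := exists_perm_succAbove σ i
  filter_upwards [(quasiMeasurePreserving_succAbove (σ i)).ae (wave_comp_perm Ψ τ)] with x hx
  rw [← hx, Function.comp_assoc, hτ, Function.comp_assoc]

end Waves

/-! ### Second quantization of nonnegative functions -/

section SecondQuant

theorem mem_secondQuant_graph {w : Photon → ℝ} {Ψ Φ : Fock} :
    (Ψ, Φ) ∈ (secondQuant w).graph ↔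
      ∀ n, wave Φ n =ᵐ[nMeasure n] fun x => ((∑ i, w (x i) : ℝ) : ℂ) * wave Ψ n x := by
  rw [secondQuant_graph]
  rfl

theorem secondQuant_symm {w : Photon → ℝ} : IsSymmetricOp (secondQuant w) := by
  intro Ψ Ψ' Φ Φ' h1 h2
  rw [mem_secondQuant_graph] at h1 h2
  have e : ∀ n, ∫ x, (inner ℂ (wave Ψ' n x) (wave Φ n x) : ℂ) ∂nMeasure n
      = ∫ x, inner ℂ (wave Ψ n x) (wave Φ' n x) ∂nMeasure n := fun n => by
    refine integral_congr_ae ?_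
    filter_upwards [h1 n, h2 n] with x hx1 hx2
    rw [hx1, hx2]
    simp only [RCLike.inner_apply, map_mul, Complex.conj_ofReal]
    ring
  exact (hasSum_inner_wave Ψ' Φ).unique (by simpa only [e] using hasSum_inner_wave Ψ Φ')

theorem re_inner_secondQuant_nonneg {w : Photon → ℝ} (hw : ∀ x, 0 ≤ w x) {Ψ Ψ' : Fock}
    (h : (Ψ, Ψ') ∈ (secondQuant w).graph) : 0 ≤ (inner ℂ Ψ Ψ').re := by
  rw [mem_secondQuant_graph] at h
  have hs := Complex.hasSum_re (hasSum_inner_wave Ψ Ψ')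
  refine hs.nonneg fun n => ?_
  have e : (∫ x, (inner ℂ (wave Ψ n x) (wave Ψ' n x) : ℂ) ∂nMeasure n).re
      = ∫ x, (inner ℂ (wave Ψ n x) (wave Ψ' n x)).re ∂nMeasure n :=
    (integral_re (integrable_inner_wave Ψ Ψ' n)).symm
  rw [e]
  refine integral_nonneg_of_ae ?_
  filter_upwards [h n] with x hx
  rw [hx, RCLike.inner_apply, mul_assoc, Complex.mul_conj]
  rw [← Complex.ofReal_mul, Complex.ofReal_re]
  exact mul_nonneg (Finset.sum_nonneg fun i _ => hw _) (Complex.normSq_nonneg _)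

/-- Bounded symmetric multiplication operators. -/
theorem exists_wave_mul (f : ∀ n, (Fin n → Photon) → ℝ) (hf : ∀ n, Measurable (f n))
    (hs : ∀ n (σ : Equiv.Perm (Fin n)) x, f n (x ∘ σ) = f n x)
    (hb : ∀ n x, |f n x| ≤ 1) (Φ : Fock) :
    ∃ Ψ : Fock, ∀ n, wave Ψ n =ᵐ[nMeasure n] fun x => (f n x : ℂ) * wave Φ n x := by
  refine exists_wave_ae_eq _ (fun n => ?_) (fun n σ => ?_) ?_
  · exact ((Complex.measurable_ofReal.comp (hf n)).aestronglyMeasurable).mul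
      (stronglyMeasurable_wave Φ n).aestronglyMeasurable
  · filter_upwards [wave_comp_perm Φ σ] with x hx
    rw [hs, hx]
  · refine ne_top_of_le_ne_top (b := ‖Φ‖ₑ ^ 2) (by simp) ?_
    rw [enorm_sq_eq_tsum]
    refine ENNReal.tsum_le_tsum fun n => lintegral_mono fun x => ?_
    gcongr
    rw [enorm_mul]
    refine mul_le_of_le_one_left' ?_
    rw [← ofReal_norm, Complex.norm_real]
    exact ENNReal.ofReal_le_one.2 (hb n x)

theorem sum_comp_perm (w : Photon → ℝ) {n : ℕ} (σ : Equiv.Perm (Fin n)) (x : Fin n → Photon) :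
    ∑ i, w ((x ∘ σ) i) = ∑ i, w (x i) :=
  Equiv.sum_comp σ fun i => w (x i)

/-- For `Φ` orthogonal to the domain put `Ψ = (1 + dΓ(w))⁻¹ Φ`, which lies in the domain. Then `0 =
⟪Ψ, Φ⟫ = ‖Ψ‖² + ⟪Ψ, dΓ(w) Ψ⟫`, and positivity forces `Ψ = 0`, hence `Φ = 0`. -/
theorem dense_secondQuant_domain {w : Photon → ℝ} (hwm : Measurable w) (hw : ∀ x, 0 ≤ w x) :
    Dense ((secondQuant w).domain : Set Fock) := by
  rw [Submodule.dense_iff_topologicalClosure_eq_top, Submodule.topologicalClosure_eq_top_iff,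
    Submodule.eq_bot_iff]
  intro Φ hΦ
  have hpos : ∀ n (x : Fin n → Photon), 0 ≤ ∑ i, w (x i) :=
    fun n x => Finset.sum_nonneg fun i _ => hw _
  have hmeas : ∀ n, Measurable fun x : Fin n → Photon => ∑ i, w (x i) := fun n =>
    Finset.measurable_sum _ fun i _ => hwm.comp (measurable_pi_apply i)
  obtain ⟨Ψ, hΨ⟩ := exists_wave_mul (fun n x => (1 + ∑ i, w (x i))⁻¹)
    (fun n => ((measurable_const.add (hmeas n)).inv))
    (fun n σ x => by rw [sum_comp_perm]) (fun n x => by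
      have := hpos n x
      rw [abs_of_nonneg (by positivity)]
      exact inv_le_one_of_one_le₀ (by linarith)) Φ
  obtain ⟨Ψ', hΨ'⟩ := exists_wave_mul (fun n x => (∑ i, w (x i)) * (1 + ∑ i, w (x i))⁻¹)
    (fun n => (hmeas n).mul ((measurable_const.add (hmeas n)).inv))
    (fun n σ x => by rw [sum_comp_perm]) (fun n x => by
      have := hpos n x
      rw [abs_of_nonneg (by positivity), ← div_eq_mul_inv]
      exact div_le_one_of_le₀ (by linarith) (by linarith)) Φ
  have hgraph : (Ψ, Ψ') ∈ (secondQuant w).graph := by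
    rw [mem_secondQuant_graph]
    intro n
    filter_upwards [hΨ n, hΨ' n] with x h1 h2
    rw [h1, h2]
    push_cast
    ring
  have hsum : Φ = Ψ + Ψ' := by
    refine fock_ext fun n => ?_
    filter_upwards [hΨ n, hΨ' n, wave_add Ψ Ψ' n] with x h1 h2 h3
    have : (1 + ∑ i, w (x i) : ℝ) ≠ 0 := by have := hpos n x; positivity
    rw [h3, h1, h2, ← add_mul, ← Complex.ofReal_add, ← one_add_mul, mul_inv_cancel₀ this,
      Complex.ofReal_one, one_mul]
  have h0 : inner ℂ Ψ Φ = 0 :=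
    (Submodule.mem_orthogonal _ _).1 hΦ Ψ (LinearPMap.mem_domain_of_mem_graph hgraph)
  rw [hsum, inner_add_right, inner_self_eq_norm_sq_to_K] at h0
  have h1 := congrArg Complex.re h0
  have h2 := re_inner_secondQuant_nonneg hw hgraph
  have h3 : (((‖Ψ‖ : ℝ) : ℂ) ^ 2).re = ‖Ψ‖ ^ 2 := by norm_cast
  rw [Complex.add_re, Complex.zero_re] at h1
  erw [h3] at h1
  have hΨ0 : Ψ = 0 := by
    rw [← norm_eq_zero]
    nlinarith [norm_nonneg Ψ]
  have hΨ'0 := LinearPMap.graph_fst_eq_zero_snd _ hgraph hΨ0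
  rw [hsum, hΨ0, hΨ'0, add_zero]

end SecondQuant

/-! ### Relative bounds for creation and annihilation operators -/

section RelativeBounds

/-- `g` is square integrable and `|g|² ≤ w |h|²` with a square integrable `h`. -/
structure IsFormFactor (w : Photon → ℝ) (g h : Photon → ℂ) : Prop where
  measurable_weight : Measurable w
  weight_nonneg : ∀ x, 0 ≤ w x
  aestronglyMeasurable : AEStronglyMeasurable g photonMeasure
  aestronglyMeasurable' : AEStronglyMeasurable h photonMeasure
  lintegral_ne_top : ∫⁻ x, ‖g x‖ₑ ^ 2 ∂photonMeasure ≠ ∞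
  lintegral_ne_top' : ∫⁻ x, ‖h x‖ₑ ^ 2 ∂photonMeasure ≠ ∞
  norm_sq_le : ∀ x, ‖g x‖ ^ 2 ≤ w x * ‖h x‖ ^ 2

theorem enorm_sq_eq_ofReal (z : ℂ) : ‖z‖ₑ ^ 2 = ENNReal.ofReal (‖z‖ ^ 2) := by
  rw [ENNReal.ofReal_pow (norm_nonneg _), ofReal_norm]

/-- The operator domain lies in the form domain, because `Ω ≤ 1 + Ω²`. -/
theorem tsum_lintegral_kinetic_ne_top {w : Photon → ℝ} {Ψ Ψ' : Fock}
    (h : (Ψ, Ψ') ∈ (secondQuant w).graph) :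
    ∑' n, ∫⁻ x, ENNReal.ofReal (∑ i, w (x i)) * ‖wave Ψ n x‖ₑ ^ 2 ∂nMeasure n ≠ ∞ := by
  rw [mem_secondQuant_graph] at h
  refine ne_top_of_le_ne_top (b := ‖Ψ‖ₑ ^ 2 + ‖Ψ'‖ₑ ^ 2) (by simp) ?_
  rw [enorm_sq_eq_tsum, enorm_sq_eq_tsum, ← ENNReal.tsum_add]
  refine ENNReal.tsum_le_tsum fun n => ?_
  rw [← lintegral_add_left ((stronglyMeasurable_wave Ψ n).enorm.pow_const 2)]
  refine lintegral_mono_ae ?_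
  filter_upwards [h n] with x hx
  rw [hx, enorm_sq_eq_ofReal, enorm_sq_eq_ofReal, ← ENNReal.ofReal_mul' (by positivity),
    ← ENNReal.ofReal_add (by positivity) (by positivity)]
  refine ENNReal.ofReal_le_ofReal ?_
  rw [norm_mul, Complex.norm_real, mul_pow, Real.norm_eq_abs, sq_abs]
  nlinarith [mul_nonneg (sq_nonneg ((∑ i, w (x i)) - 1)) (sq_nonneg ‖wave Ψ n x‖),
    sq_nonneg (((∑ i, w (x i)) + 1) * ‖wave Ψ n x‖), sq_nonneg ‖wave Ψ n x‖,
    sq_nonneg ((∑ i, w (x i)) * ‖wave Ψ n x‖)]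

theorem sq_sum_mul_le {n : ℕ} {a h w b : Fin (n + 1) → ℝ} (hw : ∀ i, 0 ≤ w i)
    (ha : ∀ i, a i ^ 2 ≤ w i * h i ^ 2) :
    (∑ i, a i * b i) ^ 2
      ≤ ∑ i, (a i ^ 2 * b i ^ 2 + h i ^ 2 * ((∑ j, w (i.succAbove j)) * b i ^ 2)) := by
  -- In an off-diagonal term the weight `w j` is paired with `h i`, and `w i` with `h j`. After this
  -- exchange the arithmetic-geometric mean inequality leaves each `h i` beside a factor in which
  -- photon `i` is absent, ready for Fubini.
  set c : Fin (n + 1) → Fin (n + 1) → ℝ :=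
    fun i j => if i = j then a i ^ 2 * b i ^ 2 else h i ^ 2 * (w j * b i ^ 2) with hc
  have h1 : ∀ i j, (a i * b i) * (a j * b j) ≤ (c i j + c j i) / 2 := by
    intro i j
    by_cases hij : i = j
    · subst hij
      simp only [hc, if_true]
      exact le_of_eq (by ring)
    · simp only [hc, if_neg hij, if_neg (Ne.symm hij)]
      set X := h i ^ 2 * (w j * b i ^ 2)
      set Y := h j ^ 2 * (w i * b j ^ 2)
      have hX : 0 ≤ X := by have := hw j; positivity
      have hY : 0 ≤ Y := by have := hw i; positivity
      have hz : ((a i * b i) * (a j * b j)) ^ 2 ≤ X * Y := by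
        calc ((a i * b i) * (a j * b j)) ^ 2
            = (a i ^ 2 * a j ^ 2) * (b i ^ 2 * b j ^ 2) := by ring
          _ ≤ ((w i * h i ^ 2) * (w j * h j ^ 2)) * (b i ^ 2 * b j ^ 2) := by
              have := hw i
              gcongr
              · exact ha i
              · exact ha j
          _ = X * Y := by simp only [X, Y]; ring
      refine le_trans (le_abs_self _) (abs_le_of_sq_le_sq ?_ (by positivity))
      nlinarith [sq_nonneg (X - Y)]
  calc (∑ i, a i * b i) ^ 2 = ∑ i, ∑ j, (a i * b i) * (a j * b j) := by
        rw [sq, Finset.sum_mul_sum]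
    _ ≤ ∑ i, ∑ j, (c i j + c j i) / 2 :=
        Finset.sum_le_sum fun i _ => Finset.sum_le_sum fun j _ => h1 i j
    _ = ∑ i, ∑ j, c i j := by
        simp only [add_div, Finset.sum_add_distrib]
        rw [Finset.sum_comm (f := fun i j => c j i / 2), ← Finset.sum_add_distrib]
        refine Finset.sum_congr rfl fun i _ => ?_
        rw [← Finset.sum_add_distrib]
        exact Finset.sum_congr rfl fun j _ => by ring
    _ = _ := by
        refine Finset.sum_congr rfl fun i _ => ?_
        rw [Fin.sum_univ_succAbove _ i]
        simp only [hc, if_true, if_neg (Fin.succAbove_ne i _).symm]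
        rw [Finset.sum_mul, Finset.mul_sum]

theorem ofReal_inv_mul_natCast (n : ℕ) :
    ENNReal.ofReal ((n + 1 : ℝ)⁻¹) * ((n + 1 : ℕ) : ℝ≥0∞) = 1 := by
  have hn0 : (0 : ℝ) < n + 1 := by positivity
  rw [ENNReal.ofReal_inv_of_pos hn0, ← Nat.cast_succ, ENNReal.ofReal_natCast]
  exact ENNReal.inv_mul_cancel (by simp) (by simp)

/-- The wave functions of `a(g)* Ψ`. -/
def creationWave (g : Photon → ℂ) (Ψ : Fock) : ∀ n, (Fin n → Photon) → ℂ
  | 0 => fun _ => 0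
  | n + 1 => fun x => ((Real.sqrt (n + 1) : ℝ) : ℂ)⁻¹ *
      ∑ i : Fin (n + 1), g (x i) * wave Ψ n (x ∘ i.succAbove)

theorem mem_creation_graph_of_wave {g : Photon → ℂ} {Ψ Φ : Fock}
    (h : ∀ n, wave Φ n =ᵐ[nMeasure n] creationWave g Ψ n) : (Ψ, Φ) ∈ (creation g).graph := by
  rw [creation_graph]
  exact ⟨h 0, fun n => h (n + 1)⟩

variable {w : Photon → ℝ} {g h : Photon → ℂ}

theorem aemeasurable_enorm_sq_apply {n : ℕ} {f : Photon → ℂ}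
    (hf : AEStronglyMeasurable f photonMeasure) (i : Fin n) :
    AEMeasurable (fun x : Fin n → Photon => ‖f (x i)‖ₑ ^ 2) (nMeasure n) :=
  ((hf.comp_quasiMeasurePreserving (quasiMeasurePreserving_apply i)).enorm).pow_const 2

theorem aestronglyMeasurable_creationWave (hg : AEStronglyMeasurable g photonMeasure) (Ψ : Fock)
    (n : ℕ) : AEStronglyMeasurable (creationWave g Ψ n) (nMeasure n) := by
  cases n with
  | zero => exact aestronglyMeasurable_const
  | succ n =>
    refine aestronglyMeasurable_const.mul (Finset.aestronglyMeasurable_fun_sum _ fun i _ => ?_)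
    exact (hg.comp_quasiMeasurePreserving (quasiMeasurePreserving_apply i)).mul
      ((stronglyMeasurable_wave Ψ n).aestronglyMeasurable.comp_quasiMeasurePreserving
        (quasiMeasurePreserving_succAbove i))

theorem creationWave_comp_perm (g : Photon → ℂ) (Ψ : Fock) (n : ℕ) (σ : Equiv.Perm (Fin n)) :
    (fun x => creationWave g Ψ n (x ∘ σ)) =ᵐ[nMeasure n] creationWave g Ψ n := by
  cases n with
  | zero => exact Filter.EventuallyEq.rfl
  | succ n =>
    filter_upwards [ae_all_iff.2 fun i => wave_succAbove_comp_perm Ψ σ i] with x hx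
    simp only [creationWave, hx, Function.comp_apply]
    rw [Equiv.sum_comp σ fun i => g (x i) * wave Ψ n (x ∘ i.succAbove)]

/-- The estimate `‖a(g)* Ψ‖² ≤ ‖g‖² ‖Ψ‖² + ‖h‖² ⟪Ψ, dΓ(w) Ψ⟫`, one photon number at a time. By
Fubini all `n + 1` summands have the same integral, which cancels the factor `(n + 1)⁻¹`. -/
theorem IsFormFactor.lintegral_creationWave_le (hf : IsFormFactor w g h) (Ψ : Fock) (n : ℕ) :
    ∫⁻ x, ‖creationWave g Ψ (n + 1) x‖ₑ ^ 2 ∂nMeasure (n + 1)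
      ≤ (∫⁻ x, ‖g x‖ₑ ^ 2 ∂photonMeasure) * (∫⁻ x, ‖wave Ψ n x‖ₑ ^ 2 ∂nMeasure n)
        + (∫⁻ x, ‖h x‖ₑ ^ 2 ∂photonMeasure)
          * ∫⁻ x, ENNReal.ofReal (∑ i, w (x i)) * ‖wave Ψ n x‖ₑ ^ 2 ∂nMeasure n := by
  have hψ : AEMeasurable (fun x => ‖wave Ψ n x‖ₑ ^ 2) (nMeasure n) :=
    ((stronglyMeasurable_wave Ψ n).enorm.pow_const 2).aemeasurable
  have hΩ : AEMeasurable (fun x => ENNReal.ofReal (∑ i, w (x i)) * ‖wave Ψ n x‖ₑ ^ 2)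
      (nMeasure n) := by
    refine AEMeasurable.mul (Measurable.aemeasurable ?_) hψ
    exact (Finset.measurable_sum _ fun i _ =>
      hf.measurable_weight.comp (measurable_pi_apply i)).ennreal_ofReal
  have hg2 : AEMeasurable (fun x => ‖g x‖ₑ ^ 2) photonMeasure :=
    hf.aestronglyMeasurable.enorm.pow_const 2
  have hh2 : AEMeasurable (fun x => ‖h x‖ₑ ^ 2) photonMeasure :=
    hf.aestronglyMeasurable'.enorm.pow_const 2
  have hn0 : (0 : ℝ) < n + 1 := by positivity
  have hpt : ∀ x : Fin (n + 1) → Photon, ‖creationWave g Ψ (n + 1) x‖ₑ ^ 2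
      ≤ ENNReal.ofReal ((n + 1 : ℝ)⁻¹) * ∑ i : Fin (n + 1),
        (‖g (x i)‖ₑ ^ 2 * ‖wave Ψ n (x ∘ i.succAbove)‖ₑ ^ 2 +
          ‖h (x i)‖ₑ ^ 2 * (ENNReal.ofReal (∑ j, w ((x ∘ i.succAbove) j))
            * ‖wave Ψ n (x ∘ i.succAbove)‖ₑ ^ 2)) := by
    intro x
    have h1 := sq_sum_mul_le (a := fun i => ‖g (x i)‖) (h := fun i => ‖h (x i)‖)
      (w := fun i => w (x i)) (b := fun i : Fin (n + 1) => ‖wave Ψ n (x ∘ i.succAbove)‖)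
      (fun i => hf.weight_nonneg _) (fun i => hf.norm_sq_le _)
    have h2 : ‖creationWave g Ψ (n + 1) x‖ ^ 2 ≤ (n + 1 : ℝ)⁻¹ *
        (∑ i : Fin (n + 1), ‖g (x i)‖ * ‖wave Ψ n (x ∘ i.succAbove)‖) ^ 2 := by
      simp only [creationWave]
      rw [norm_mul, mul_pow, norm_inv, Complex.norm_real, Real.norm_eq_abs, inv_pow, sq_abs,
        Real.sq_sqrt hn0.le]
      gcongr
      refine (norm_sum_le _ _).trans (le_of_eq ?_)
      simp only [norm_mul]
    rw [enorm_sq_eq_ofReal]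
    refine (ENNReal.ofReal_le_ofReal (h2.trans
      (mul_le_mul_of_nonneg_left h1 (inv_nonneg.2 hn0.le)))).trans (le_of_eq ?_)
    have hΩ0 : ∀ i : Fin (n + 1), 0 ≤ ∑ j, w (x (i.succAbove j)) := fun i =>
      Finset.sum_nonneg fun j _ => hf.weight_nonneg _
    rw [ENNReal.ofReal_mul (inv_nonneg.2 hn0.le), ENNReal.ofReal_sum_of_nonneg
      (fun i _ => by have := hΩ0 i; positivity)]
    congr 1
    refine Finset.sum_congr rfl fun i _ => ?_
    have := hΩ0 i
    rw [ENNReal.ofReal_add (by positivity) (by positivity), ENNReal.ofReal_mul (by positivity),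
      ENNReal.ofReal_mul (by positivity), ENNReal.ofReal_mul (by positivity),
      enorm_sq_eq_ofReal, enorm_sq_eq_ofReal, enorm_sq_eq_ofReal]
    rfl
  refine (lintegral_mono hpt).trans ?_
  have hm1 : ∀ i : Fin (n + 1), AEMeasurable (fun x : Fin (n + 1) → Photon =>
      ‖g (x i)‖ₑ ^ 2 * ‖wave Ψ n (x ∘ i.succAbove)‖ₑ ^ 2) (nMeasure (n + 1)) := fun i =>
    (aemeasurable_enorm_sq_apply hf.aestronglyMeasurable i).mul
      (hψ.comp_quasiMeasurePreserving (quasiMeasurePreserving_succAbove i))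
  have hm2 : ∀ i : Fin (n + 1), AEMeasurable (fun x : Fin (n + 1) → Photon =>
      ‖h (x i)‖ₑ ^ 2 * (ENNReal.ofReal (∑ j, w ((x ∘ i.succAbove) j))
            * ‖wave Ψ n (x ∘ i.succAbove)‖ₑ ^ 2)) (nMeasure (n + 1)) := fun i =>
    (aemeasurable_enorm_sq_apply hf.aestronglyMeasurable' i).mul
      (hΩ.comp_quasiMeasurePreserving (quasiMeasurePreserving_succAbove i))
  have hm3 : ∀ i : Fin (n + 1), AEMeasurable (fun x : Fin (n + 1) → Photon =>
      ‖g (x i)‖ₑ ^ 2 * ‖wave Ψ n (x ∘ i.succAbove)‖ₑ ^ 2 +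
          ‖h (x i)‖ₑ ^ 2 * (ENNReal.ofReal (∑ j, w ((x ∘ i.succAbove) j))
            * ‖wave Ψ n (x ∘ i.succAbove)‖ₑ ^ 2)) (nMeasure (n + 1)) := fun i =>
    (hm1 i).add (hm2 i)
  rw [lintegral_const_mul' _ _ ENNReal.ofReal_ne_top,
    lintegral_finsetSum' _ fun i _ => hm3 i]
  have : ∀ i : Fin (n + 1), ∫⁻ x : Fin (n + 1) → Photon,
      (‖g (x i)‖ₑ ^ 2 * ‖wave Ψ n (x ∘ i.succAbove)‖ₑ ^ 2 +
          ‖h (x i)‖ₑ ^ 2 * (ENNReal.ofReal (∑ j, w ((x ∘ i.succAbove) j))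
            * ‖wave Ψ n (x ∘ i.succAbove)‖ₑ ^ 2)) ∂nMeasure (n + 1)
      = (∫⁻ x, ‖g x‖ₑ ^ 2 ∂photonMeasure) * (∫⁻ x, ‖wave Ψ n x‖ₑ ^ 2 ∂nMeasure n)
        + (∫⁻ x, ‖h x‖ₑ ^ 2 ∂photonMeasure)
          * ∫⁻ x, ENNReal.ofReal (∑ i, w (x i)) * ‖wave Ψ n x‖ₑ ^ 2 ∂nMeasure n := by
    intro i
    rw [lintegral_add_left' (hm1 i), lintegral_succAbove i hg2 hψ, lintegral_succAbove i hh2 hΩ]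
  simp only [this, Finset.sum_const, Finset.card_univ, Fintype.card_fin, nsmul_eq_mul]
  rw [← mul_assoc, ofReal_inv_mul_natCast, one_mul]

/-- Vectors in the domain of `dΓ(w)` are in the domain of the creation operator. -/
theorem IsFormFactor.exists_creation (hf : IsFormFactor w g h) {Ψ : Fock}
    (hΨ : Ψ ∈ (secondQuant w).domain) : ∃ Φ, (Ψ, Φ) ∈ (creation g).graph := by
  obtain ⟨Ψ', hΨ'⟩ := LinearPMap.mem_domain_iff.1 hΨ
  have hK := tsum_lintegral_kinetic_ne_top hΨ'
  obtain ⟨Φ, hΦ⟩ := exists_wave_ae_eq (creationWave g Ψ)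
    (aestronglyMeasurable_creationWave hf.aestronglyMeasurable Ψ)
    (creationWave_comp_perm g Ψ) (by
      rw [tsum_eq_zero_add' ENNReal.summable]
      have h0 : ∫⁻ x, ‖creationWave g Ψ 0 x‖ₑ ^ 2 ∂nMeasure 0 = 0 := by simp [creationWave]
      rw [h0, zero_add]
      refine ne_top_of_le_ne_top ?_
        (ENNReal.tsum_le_tsum fun n => hf.lintegral_creationWave_le Ψ n)
      rw [ENNReal.tsum_add, ENNReal.tsum_mul_left, ENNReal.tsum_mul_left, ← enorm_sq_eq_tsum]
      exact ENNReal.add_ne_top.2 ⟨ENNReal.mul_ne_top hf.lintegral_ne_top (by simp),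
        ENNReal.mul_ne_top hf.lintegral_ne_top' hK⟩)
  exact ⟨Φ, mem_creation_graph_of_wave hΦ⟩

theorem IsFormFactor.dense_creation_domain (hf : IsFormFactor w g h) :
    Dense ((creation g).domain : Set Fock) := by
  refine (dense_secondQuant_domain hf.measurable_weight hf.weight_nonneg).mono fun Ψ hΨ => ?_
  obtain ⟨Φ, hΦ⟩ := hf.exists_creation hΨ
  exact LinearPMap.mem_domain_of_mem_graph hΦ

theorem mul_sum_mul_le {n : ℕ} {a h w b : Fin (n + 1) → ℝ} {c : ℝ} (hw : ∀ i, 0 ≤ w i)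
    (ha : ∀ i, a i ^ 2 ≤ w i * h i ^ 2) :
    c * (Real.sqrt (n + 1))⁻¹ * ∑ i, a i * b i
      ≤ (∑ i, w i) * c ^ 2 + (n + 1 : ℝ)⁻¹ * ∑ i, h i ^ 2 * b i ^ 2 := by
  have hn0 : (0 : ℝ) < n + 1 := by positivity
  rw [Finset.mul_sum, Finset.mul_sum, Finset.sum_mul, ← Finset.sum_add_distrib]
  refine Finset.sum_le_sum fun i _ => ?_
  have hs : (Real.sqrt (n + 1))⁻¹ ^ 2 = (n + 1 : ℝ)⁻¹ := by
    rw [inv_pow, Real.sq_sqrt hn0.le]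
  set s := (Real.sqrt (n + 1 : ℝ))⁻¹
  rw [← hs]
  set X := w i * c ^ 2
  set Y := s ^ 2 * (h i ^ 2 * b i ^ 2)
  have hX : 0 ≤ X := by have := hw i; positivity
  have hY : 0 ≤ Y := by positivity
  have hz : (c * s * (a i * b i)) ^ 2 ≤ X * Y := by
    calc (c * s * (a i * b i)) ^ 2 = a i ^ 2 * (c ^ 2 * s ^ 2 * b i ^ 2) := by ring
      _ ≤ (w i * h i ^ 2) * (c ^ 2 * s ^ 2 * b i ^ 2) := by
          gcongr
          exact ha i
      _ = X * Y := by simp only [X, Y]; ring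
  refine le_trans (le_abs_self _) (abs_le_of_sq_le_sq ?_ (by positivity))
  nlinarith [mul_nonneg hX hY]

/-- The whole weight is put on `Ψ`, leaving only the norm of `Φ`; thus `Φ ↦ ⟪Ψ, a(g)* Φ⟫` is bounded
when `Ψ` has finite kinetic energy. -/
theorem IsFormFactor.lintegral_mul_creationWave_le (hf : IsFormFactor w g h) (Ψ Φ : Fock) (n : ℕ) :
    ∫⁻ x, ‖wave Ψ (n + 1) x‖ₑ * ‖creationWave g Φ (n + 1) x‖ₑ ∂nMeasure (n + 1)
      ≤ (∫⁻ x, ENNReal.ofReal (∑ i, w (x i)) * ‖wave Ψ (n + 1) x‖ₑ ^ 2 ∂nMeasure (n + 1))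
        + (∫⁻ x, ‖h x‖ₑ ^ 2 ∂photonMeasure) * ∫⁻ x, ‖wave Φ n x‖ₑ ^ 2 ∂nMeasure n := by
  have hφ : AEMeasurable (fun x => ‖wave Φ n x‖ₑ ^ 2) (nMeasure n) :=
    ((stronglyMeasurable_wave Φ n).enorm.pow_const 2).aemeasurable
  have hΩ : Measurable (fun x => ENNReal.ofReal (∑ i, w (x i)) * ‖wave Ψ (n + 1) x‖ₑ ^ 2) := by
    refine Measurable.mul ?_ ((stronglyMeasurable_wave Ψ (n + 1)).enorm.pow_const 2)
    exact (Finset.measurable_sum _ fun i _ =>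
      hf.measurable_weight.comp (measurable_pi_apply i)).ennreal_ofReal
  have hh2 : AEMeasurable (fun x => ‖h x‖ₑ ^ 2) photonMeasure :=
    hf.aestronglyMeasurable'.enorm.pow_const 2
  have hn0 : (0 : ℝ) < n + 1 := by positivity
  have hpt : ∀ x : Fin (n + 1) → Photon,
      ‖wave Ψ (n + 1) x‖ₑ * ‖creationWave g Φ (n + 1) x‖ₑ
      ≤ ENNReal.ofReal (∑ i, w (x i)) * ‖wave Ψ (n + 1) x‖ₑ ^ 2
        + ENNReal.ofReal ((n + 1 : ℝ)⁻¹) * ∑ i : Fin (n + 1),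
          ‖h (x i)‖ₑ ^ 2 * ‖wave Φ n (x ∘ i.succAbove)‖ₑ ^ 2 := by
    intro x
    have h1 := mul_sum_mul_le (a := fun i => ‖g (x i)‖) (h := fun i => ‖h (x i)‖)
      (w := fun i => w (x i)) (b := fun i : Fin (n + 1) => ‖wave Φ n (x ∘ i.succAbove)‖)
      (c := ‖wave Ψ (n + 1) x‖) (fun i => hf.weight_nonneg _) (fun i => hf.norm_sq_le _)
    have h2 : ‖wave Ψ (n + 1) x‖ * ‖creationWave g Φ (n + 1) x‖
        ≤ ‖wave Ψ (n + 1) x‖ * (Real.sqrt (n + 1))⁻¹ *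
          ∑ i : Fin (n + 1), ‖g (x i)‖ * ‖wave Φ n (x ∘ i.succAbove)‖ := by
      simp only [creationWave]
      rw [norm_mul, norm_inv, Complex.norm_real, Real.norm_eq_abs,
        abs_of_nonneg (Real.sqrt_nonneg _), mul_assoc]
      gcongr
      refine (norm_sum_le _ _).trans (le_of_eq ?_)
      simp only [norm_mul]
    have hΩ0 : 0 ≤ ∑ i, w (x i) := Finset.sum_nonneg fun j _ => hf.weight_nonneg _
    rw [← ofReal_norm, ← ofReal_norm, ← ENNReal.ofReal_mul (norm_nonneg _)]
    refine (ENNReal.ofReal_le_ofReal (h2.trans h1)).trans (le_of_eq ?_)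
    have h3 : ∀ i : Fin (n + 1), 0 ≤ ‖h (x i)‖ ^ 2 * ‖wave Φ n (x ∘ i.succAbove)‖ ^ 2 :=
      fun i => by positivity
    rw [ENNReal.ofReal_add (by positivity) (by positivity), ENNReal.ofReal_mul hΩ0,
      ENNReal.ofReal_mul (inv_nonneg.2 hn0.le), ENNReal.ofReal_sum_of_nonneg (fun i _ => h3 i),
      ENNReal.ofReal_pow (norm_nonneg _), ofReal_norm]
    congr 2
    refine Finset.sum_congr rfl fun i _ => ?_
    rw [ENNReal.ofReal_mul (by positivity), enorm_sq_eq_ofReal, enorm_sq_eq_ofReal]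
  refine (lintegral_mono hpt).trans ?_
  have hm2 : ∀ i : Fin (n + 1), AEMeasurable (fun x : Fin (n + 1) → Photon =>
      ‖h (x i)‖ₑ ^ 2 * ‖wave Φ n (x ∘ i.succAbove)‖ₑ ^ 2) (nMeasure (n + 1)) := fun i =>
    (aemeasurable_enorm_sq_apply hf.aestronglyMeasurable' i).mul
      (hφ.comp_quasiMeasurePreserving (quasiMeasurePreserving_succAbove i))
  rw [lintegral_add_left hΩ, lintegral_const_mul' _ _ ENNReal.ofReal_ne_top,
    lintegral_finsetSum' _ fun i _ => hm2 i]
  refine add_le_add le_rfl ?_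
  simp only [lintegral_succAbove _ hh2 hφ, Finset.sum_const, Finset.card_univ, Fintype.card_fin,
    nsmul_eq_mul]
  rw [← mul_assoc, ofReal_inv_mul_natCast, one_mul]

/-- Vectors in the domain of `dΓ(w)` are in the domain of the annihilation operator. -/
theorem IsFormFactor.mem_annihilation_domain (hf : IsFormFactor w g h) {Ψ : Fock}
    (hΨ : Ψ ∈ (secondQuant w).domain) : Ψ ∈ (annihilation g).domain := by
  obtain ⟨Ψ', hΨ'⟩ := LinearPMap.mem_domain_iff.1 hΨ
  have hK := tsum_lintegral_kinetic_ne_top hΨ'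
  set K := ∑' n, ∫⁻ x, ENNReal.ofReal (∑ i, w (x i)) * ‖wave Ψ n x‖ₑ ^ 2 ∂nMeasure n
  set H := ∫⁻ x, ‖h x‖ₑ ^ 2 ∂photonMeasure
  have hH : H ≠ ∞ := hf.lintegral_ne_top'
  have key : ∀ Φ : (creation g).domain,
      ‖inner ℂ Ψ (creation g Φ)‖ ≤ K.toReal + H.toReal * ‖(Φ : Fock)‖ ^ 2 := by
    intro Φ
    have hg : ((Φ : Fock), creation g Φ) ∈ creationGraph g := by
      rw [← creation_graph]
      exact LinearPMap.mem_graph _ Φ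
    have h1 : ‖inner ℂ Ψ (creation g Φ)‖ₑ ≤ K + H * ‖(Φ : Fock)‖ₑ ^ 2 := by
      refine (enorm_inner_le_tsum _ _).trans ?_
      rw [tsum_eq_zero_add' ENNReal.summable]
      have h0 : ∫⁻ x, ‖wave Ψ 0 x‖ₑ * ‖wave (creation g Φ) 0 x‖ₑ ∂nMeasure 0 = 0 := by
        rw [lintegral_eq_zero_of_ae_eq_zero]
        filter_upwards [hg.1] with x hx
        simp [hx]
      rw [h0, zero_add]
      calc _ ≤ ∑' n, ((∫⁻ x, ENNReal.ofReal (∑ i, w (x i)) * ‖wave Ψ (n + 1) x‖ₑ ^ 2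
                ∂nMeasure (n + 1)) + H * ∫⁻ x, ‖wave Φ n x‖ₑ ^ 2 ∂nMeasure n) := by
            refine ENNReal.tsum_le_tsum fun n => le_trans (le_of_eq ?_)
              (hf.lintegral_mul_creationWave_le Ψ Φ n)
            refine lintegral_congr_ae ?_
            filter_upwards [hg.2 n] with x hx
            rw [hx]
            rfl
        _ ≤ _ := by
            rw [ENNReal.tsum_add, ENNReal.tsum_mul_left, ← enorm_sq_eq_tsum]
            refine add_le_add ?_ le_rfl
            simp only [K]
            rw [tsum_eq_zero_add' (f := fun n => ∫⁻ x : Fin n → Photon,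
              ENNReal.ofReal (∑ i, w (x i)) * ‖wave Ψ n x‖ₑ ^ 2 ∂nMeasure n) ENNReal.summable]
            exact le_add_self
    have h2 := ENNReal.toReal_mono (ENNReal.add_ne_top.2 ⟨hK, ENNReal.mul_ne_top hH (by simp)⟩) h1
    rw [ENNReal.toReal_add hK (ENNReal.mul_ne_top hH (by simp)), ENNReal.toReal_mul,
      ENNReal.toReal_pow] at h2
    simpa using h2
  rw [annihilation, LinearPMap.mem_adjoint_domain_iff]
  refine AddMonoidHomClass.continuous_of_bound _ (K.toReal + H.toReal) fun Φ => ?_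
  change ‖inner ℂ Ψ (creation g Φ)‖ ≤ _
  rcases eq_or_ne Φ 0 with rfl | h0
  · simp
  have hn : (0 : ℝ) < ‖(Φ : Fock)‖ := norm_pos_iff.2 (by simpa using h0)
  -- The bound `K + H ‖Φ‖²` is not homogeneous; applied to the normalized vector it becomes the
  -- linear bound `(K + H) ‖Φ‖`.
  have h3 := key (((‖(Φ : Fock)‖⁻¹ : ℝ) : ℂ) • Φ)
  rw [LinearPMap.map_smul, inner_smul_right, norm_mul, Submodule.coe_smul, norm_smul,
    Complex.norm_real, norm_inv, norm_norm, inv_mul_cancel₀ hn.ne', one_pow, mul_one,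
    inv_mul_le_iff₀ hn] at h3
  rw [mul_comm]
  exact h3

/-- On the domain of `dΓ(w)` the Segal field operator is `2^{-1/2} (a(g) + a(g)*)`, where the
annihilation operator is the formal adjoint of the creation operator. -/
theorem IsFormFactor.exists_segalField (hf : IsFormFactor w g h) {Ψ : Fock}
    (hΨ : Ψ ∈ (secondQuant w).domain) :
    ∃ a c : Fock, (Ψ, c) ∈ (creation g).graph ∧
      (∀ Φ d, (Φ, d) ∈ (creation g).graph → inner ℂ a Φ = inner ℂ Ψ d) ∧
      (Ψ, (((Real.sqrt 2)⁻¹ : ℝ) : ℂ) • (a + c)) ∈ (segalField g).graph := by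
  obtain ⟨c, hc⟩ := hf.exists_creation hΨ
  have ha := hf.mem_annihilation_domain hΨ
  have hc' := LinearPMap.mem_domain_of_mem_graph hc
  refine ⟨annihilation g ⟨Ψ, ha⟩, c, hc, ?_, ?_⟩
  · intro Φ d hd
    obtain ⟨⟨Φ', h1⟩, h2, h3⟩ := (LinearPMap.mem_graph_iff _).1 hd
    dsimp only at h2 h3
    subst h2 h3
    exact LinearPMap.adjoint_isFormalAdjoint hf.dense_creation_domain ⟨Ψ, ha⟩ ⟨Φ', h1⟩
  · have h1 : (Ψ, annihilation g ⟨Ψ, ha⟩ + c) ∈ (annihilation g + creation g).graph := by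
      rw [LinearPMap.mem_graph_iff]
      refine ⟨⟨Ψ, ha, hc'⟩, rfl, ?_⟩
      rw [LinearPMap.add_apply]
      congr 1
      exact LinearPMap.mem_graph_snd_inj _ (LinearPMap.mem_graph _ ⟨Ψ, hc'⟩) hc rfl
    have h2 := LinearPMap.le_graph_of_le (LinearPMap.le_closure _) h1
    rw [segalField, LinearPMap.smul_graph]
    exact ⟨_, h2, by simp⟩

end RelativeBounds

/-! ### Unitary transformations of the photon field -/

section Slices

/-- The configuration with given momenta and polarizations. -/
def config {n : ℕ} (k : Fin n → R3) (l : Fin n → Fin 2) : Fin n → Photon := fun i => (k i, l i)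

theorem measurable_config {n : ℕ} (l : Fin n → Fin 2) :
    Measurable fun k : Fin n → R3 => config k l :=
  measurable_pi_lambda _ fun i => (measurable_pi_apply i).prodMk measurable_const

theorem measurableEmbedding_config {n : ℕ} (l : Fin n → Fin 2) :
    MeasurableEmbedding fun k : Fin n → R3 => config k l :=
  (measurable_config l).measurableEmbedding fun _ _ h => funext fun i =>
    congrArg (fun x : Fin n → Photon => (x i).1) h

/-- Configuration space is `2ⁿ` copies of momentum space, one for each polarization string. Photon
rotations mix these copies by a finite matrix at fixed momenta, so their properties reduce to
Lebesgue measure and linear algebra. -/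
theorem nMeasure_eq_sum (n : ℕ) :
    nMeasure n = Measure.sum fun l : Fin n → Fin 2 =>
      Measure.map (fun k => config k l) (volume : Measure (Fin n → R3)) := by
  have hmp := measurePreserving_arrowProdEquivProdArrow R3 (Fin 2) (Fin n)
    (fun _ => volume) (fun _ => Measure.count)
  ext S hS
  rw [Measure.sum_apply _ hS, tsum_fintype]
  have h1 : nMeasure n S = ∫⁻ z : (Fin n → R3) × (Fin n → Fin 2),
      S.indicator 1 (config z.1 z.2)
        ∂((Measure.pi fun _ => volume).prod (Measure.pi fun _ => Measure.count)) := by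
    rw [← lintegral_indicator_one hS]
    exact (hmp.lintegral_comp_emb (MeasurableEquiv.measurableEmbedding _)
      (fun z => S.indicator 1 (config z.1 z.2))).symm ▸ rfl
  have hm : Measurable fun z : (Fin n → R3) × (Fin n → Fin 2) => config z.1 z.2 :=
    measurable_pi_lambda _ fun i => ((measurable_pi_apply i).comp measurable_fst).prodMk
      ((measurable_pi_apply i).comp measurable_snd)
  have hm' : Measurable fun z : (Fin n → R3) × (Fin n → Fin 2) =>
      S.indicator (1 : (Fin n → Photon) → ℝ≥0∞) (config z.1 z.2) := (measurable_one.indicator hS).comp hm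
  rw [h1, lintegral_prod_symm _ hm'.aemeasurable, lintegral_fintype]
  refine Finset.sum_congr rfl fun l _ => ?_
  rw [Measure.pi_singleton]
  simp only [Measure.count_singleton, Finset.prod_const_one, mul_one]
  rw [Measure.map_apply (measurable_config l) hS, ← lintegral_indicator_one (measurable_config l hS)]
  rfl

theorem ae_nMeasure_iff {n : ℕ} {P : (Fin n → Photon) → Prop} :
    (∀ᵐ x ∂nMeasure n, P x) ↔ ∀ l, ∀ᵐ k : Fin n → R3, P (config k l) := by
  rw [nMeasure_eq_sum, Measure.ae_sum_iff]
  exact forall_congr' fun l => (measurableEmbedding_config l).ae_map_iff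

theorem lintegral_nMeasure {n : ℕ} (F : (Fin n → Photon) → ℝ≥0∞) :
    ∫⁻ x, F x ∂nMeasure n = ∑ l, ∫⁻ k : Fin n → R3, F (config k l) := by
  rw [nMeasure_eq_sum, lintegral_sum_measure, tsum_fintype]
  exact Finset.sum_congr rfl fun l _ => (measurableEmbedding_config l).lintegral_map _

theorem ae_photonMeasure_of_forall {P : Photon → Prop} (h : ∀ᵐ k : R3, ∀ l, P (k, l)) :
    ∀ᵐ x ∂photonMeasure, P x := by
  have := (Measure.quasiMeasurePreserving_fst (μ := (volume : Measure R3))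
    (ν := (Measure.count : Measure (Fin 2)))).ae h
  filter_upwards [this] with x hx using hx x.2

theorem measurePreserving_comp_left {n : ℕ} (T : R3 ≃ₗᵢ[ℝ] R3) :
    MeasurePreserving (fun k : Fin n → R3 => fun i => T (k i)) :=
  volume_preserving_pi fun _ => T.measurePreserving

end Slices

/-! ### Tensor products of `2 × 2` matrices -/

section TensorPower

/-- The tensor product of matrices. -/
def tensorMatrix {n : ℕ} (A : Fin n → Matrix (Fin 2) (Fin 2) ℂ) :
    Matrix (Fin n → Fin 2) (Fin n → Fin 2) ℂ :=
  Matrix.of fun l μ => ∏ i, A i (l i) (μ i)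

theorem tensorMatrix_mul {n : ℕ} (A B : Fin n → Matrix (Fin 2) (Fin 2) ℂ) :
    tensorMatrix A * tensorMatrix B = tensorMatrix fun i => A i * B i := by
  ext l ν
  simp only [Matrix.mul_apply, tensorMatrix, Matrix.of_apply]
  rw [Finset.prod_univ_sum, Fintype.piFinset_univ]
  exact Finset.sum_congr rfl fun μ _ => Finset.prod_mul_distrib.symm

theorem tensorMatrix_one (n : ℕ) : tensorMatrix (fun _ : Fin n => 1) = 1 := by
  ext l μ
  simp only [tensorMatrix, Matrix.of_apply, Matrix.one_apply]
  rw [Finset.prod_ite_zero]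
  simp [funext_iff]

theorem tensorMatrix_conjTranspose {n : ℕ} (A : Fin n → Matrix (Fin 2) (Fin 2) ℂ) :
    (tensorMatrix A).conjTranspose = tensorMatrix fun i => (A i).conjTranspose := by
  ext l μ
  simp [tensorMatrix, Matrix.conjTranspose_apply]

theorem sum_enorm_sq_mulVec {ι : Type*} [Fintype ι] [DecidableEq ι] {A : Matrix ι ι ℂ}
    (hA : A.conjTranspose * A = 1) (v : ι → ℂ) :
    ∑ i, ‖A.mulVec v i‖ₑ ^ 2 = ∑ i, ‖v i‖ₑ ^ 2 := by
  have key : ∀ u : ι → ℂ, ((∑ i, ‖u i‖ ^ 2 : ℝ) : ℂ) = star u ⬝ᵥ u := by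
    intro u
    simp only [dotProduct, Pi.star_apply, RCLike.star_def]
    push_cast
    exact Finset.sum_congr rfl fun i _ => (Complex.conj_mul' _).symm
  have h : ∑ i, ‖A.mulVec v i‖ ^ 2 = ∑ i, ‖v i‖ ^ 2 := by
    have : ((∑ i, ‖A.mulVec v i‖ ^ 2 : ℝ) : ℂ) = ((∑ i, ‖v i‖ ^ 2 : ℝ) : ℂ) := by
      rw [key, key, Matrix.star_mulVec, Matrix.dotProduct_mulVec, Matrix.vecMul_vecMul, hA,
        Matrix.vecMul_one]
    exact_mod_cast this
  simp only [enorm_sq_eq_ofReal]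
  rw [← ENNReal.ofReal_sum_of_nonneg (fun i _ => by positivity), h,
    ENNReal.ofReal_sum_of_nonneg (fun i _ => by positivity)]

end TensorPower

/-- A unitary operator `(u f)(k, λ) = ∑ᵤ w(k)_{λ μ} f(T k, μ)` on the one-photon space. -/
structure PhotonRotation where
  T : R3 ≃ₗᵢ[ℝ] R3
  w : R3 → Matrix (Fin 2) (Fin 2) ℂ
  measurable_w : ∀ a b, Measurable fun k => w k a b
  conj_mul_w : ∀ k, (w k).conjTranspose * w k = 1

namespace PhotonRotation

variable (V : PhotonRotation)

theorem w_mul_conj (k : R3) : V.w k * (V.w k).conjTranspose = 1 :=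
  mul_eq_one_comm.1 (V.conj_mul_w k)

/-- The inverse unitary operator. -/
def inv : PhotonRotation where
  T := V.T.symm
  w k := (V.w (V.T.symm k)).conjTranspose
  measurable_w a b := by
    simp only [Matrix.conjTranspose_apply]
    exact (continuous_star.measurable).comp
      ((V.measurable_w b a).comp V.T.symm.continuous.measurable)
  conj_mul_w k := by
    rw [Matrix.conjTranspose_conjTranspose]
    exact V.w_mul_conj _

/-- The action on functions of `n` photons. -/
def act {n : ℕ} (F : (Fin n → Photon) → ℂ) (x : Fin n → Photon) : ℂ :=
  (tensorMatrix fun i => V.w (x i).1).mulVec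
    (fun μ => F (config (fun i => V.T (x i).1) μ)) fun i => (x i).2

theorem act_apply {n : ℕ} (F : (Fin n → Photon) → ℂ) (x : Fin n → Photon) :
    V.act F x = ∑ μ : Fin n → Fin 2, (∏ i, V.w (x i).1 (x i).2 (μ i)) *
      F (config (fun i => V.T (x i).1) μ) := rfl

theorem act_inv_act {n : ℕ} (F : (Fin n → Photon) → ℂ) : V.inv.act (V.act F) = F := by
  funext x
  have h : (fun μ : Fin n → Fin 2 => V.act F (config (fun i => V.inv.T (x i).1) μ))
      = (tensorMatrix fun i => V.w (V.T.symm (x i).1)).mulVec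
        fun μ => F (config (fun i => (x i).1) μ) := by
    funext μ
    simp [act, config, inv]
  rw [act, h, Matrix.mulVec_mulVec, tensorMatrix_mul]
  have h2 : (fun i => V.inv.w (x i).1 * V.w (V.T.symm (x i).1)) = fun _ => 1 :=
    funext fun i => V.conj_mul_w _
  rw [h2, tensorMatrix_one, Matrix.one_mulVec]
  rfl

theorem act_act_inv {n : ℕ} (F : (Fin n → Photon) → ℂ) : V.act (V.inv.act F) = F := by
  funext x
  have h : (fun μ : Fin n → Fin 2 => V.inv.act F (config (fun i => V.T (x i).1) μ))
      = (tensorMatrix fun i => (V.w (x i).1).conjTranspose).mulVec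
        fun μ => F (config (fun i => (x i).1) μ) := by
    funext μ
    simp [act, config, inv]
  rw [act, h, Matrix.mulVec_mulVec, tensorMatrix_mul]
  simp only [V.w_mul_conj]
  rw [tensorMatrix_one, Matrix.one_mulVec]
  rfl

theorem act_congr_ae {n : ℕ} {F G : (Fin n → Photon) → ℂ} (h : F =ᵐ[nMeasure n] G) :
    V.act F =ᵐ[nMeasure n] V.act G := by
  refine ae_nMeasure_iff.2 fun l => ?_
  have h1 := ae_all_iff.2 (ae_nMeasure_iff.1 h)
  filter_upwards [(measurePreserving_comp_left (n := n) V.T).quasiMeasurePreserving.ae h1] with k hk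
  simp only [act_apply, config] at hk ⊢
  exact Finset.sum_congr rfl fun μ _ => by rw [hk]

theorem measurable_act {n : ℕ} {F : (Fin n → Photon) → ℂ} (hF : Measurable F) :
    Measurable (V.act F) := by
  have hw : Measurable fun z : Photon × Fin 2 => V.w z.1.1 z.1.2 z.2 := by
    have : Measurable fun z : R3 × (Fin 2 × Fin 2) => V.w z.1 z.2.1 z.2.2 :=
      measurable_from_prod_countable_left fun ab => V.measurable_w ab.1 ab.2
    exact this.comp ((measurable_fst.comp measurable_fst).prodMk
      ((measurable_snd.comp measurable_fst).prodMk measurable_snd))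
  change Measurable fun x : Fin n → Photon =>
    ∑ μ : Fin n → Fin 2, (∏ i, V.w (x i).1 (x i).2 (μ i)) * F (config (fun i => V.T (x i).1) μ)
  refine Finset.measurable_sum _ fun μ _ => Measurable.mul ?_ (hF.comp ?_)
  · exact Finset.measurable_prod _ fun i _ =>
      hw.comp (f := fun x : Fin n → Photon => (x i, μ i))
        ((measurable_pi_apply i).prodMk measurable_const)
  · exact measurable_pi_lambda _ fun i =>
      (V.T.continuous.measurable.comp (measurable_fst.comp (measurable_pi_apply i))).prodMk
        measurable_const

/-- At fixed momenta the tensor product matrix is unitary on polarizations, and `T` preserves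
Lebesgue measure. -/
theorem lintegral_act {n : ℕ} {F : (Fin n → Photon) → ℂ} (hF : Measurable F) :
    ∫⁻ x, ‖V.act F x‖ₑ ^ 2 ∂nMeasure n = ∫⁻ x, ‖F x‖ₑ ^ 2 ∂nMeasure n := by
  have hF2 : Measurable fun x => ‖F x‖ₑ ^ 2 := hF.enorm.pow_const 2
  have hA2 : Measurable fun x => ‖V.act F x‖ₑ ^ 2 := (V.measurable_act hF).enorm.pow_const 2
  have hF3 : ∀ l : Fin n → Fin 2, Measurable fun k : Fin n → R3 => ‖F (config k l)‖ₑ ^ 2 :=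
    fun l => hF2.comp (measurable_config l)
  have hA3 : ∀ l : Fin n → Fin 2, Measurable fun k : Fin n → R3 => ‖V.act F (config k l)‖ₑ ^ 2 :=
    fun l => hA2.comp (measurable_config l)
  rw [lintegral_nMeasure, lintegral_nMeasure, ← lintegral_finsetSum _ fun l _ => hA3 l,
    ← lintegral_finsetSum _ fun l _ => hF3 l,
    ← (measurePreserving_comp_left (n := n) V.T).lintegral_comp
      (Finset.measurable_sum _ fun l _ => hF3 l)]
  refine lintegral_congr fun k => ?_
  refine sum_enorm_sq_mulVec (A := tensorMatrix fun i => V.w (k i)) ?_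
    fun μ => F (config (fun i => V.T (k i)) μ)
  rw [tensorMatrix_conjTranspose, tensorMatrix_mul]
  simp only [V.conj_mul_w]
  exact tensorMatrix_one n

theorem act_comp_perm {n : ℕ} (F : (Fin n → Photon) → ℂ) (σ : Equiv.Perm (Fin n))
    (x : Fin n → Photon) : V.act F (x ∘ σ) = V.act (fun y => F (y ∘ σ)) x := by
  rw [act_apply, act_apply, ← Equiv.sum_comp (σ.symm.arrowCongr (Equiv.refl (Fin 2)))]
  refine Finset.sum_congr rfl fun μ _ => ?_
  congr 1
  exact Equiv.prod_comp σ fun i => V.w (x i).1 (x i).2 (μ i)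

theorem exists_wave_act (Ψ : Fock) :
    ∃ Φ : Fock, ∀ n, wave Φ n =ᵐ[nMeasure n] V.act (wave Ψ n) := by
  have hm : ∀ n, Measurable (wave Ψ n) := fun n => (stronglyMeasurable_wave Ψ n).measurable
  refine exists_wave_ae_eq _ (fun n => (V.measurable_act (hm n)).aestronglyMeasurable)
    (fun n σ => ?_) ?_
  · simp only [act_comp_perm]
    exact V.act_congr_ae (wave_comp_perm Ψ σ)
  · simp only [V.lintegral_act (hm _), ← enorm_sq_eq_tsum]
    simp

/-- The second quantization of the unitary operator, as a function. -/
def rotateFun (Ψ : Fock) : Fock := Classical.choose (V.exists_wave_act Ψ)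

theorem wave_rotateFun (Ψ : Fock) (n : ℕ) :
    wave (V.rotateFun Ψ) n =ᵐ[nMeasure n] V.act (wave Ψ n) :=
  Classical.choose_spec (V.exists_wave_act Ψ) n

theorem enorm_rotateFun (Ψ : Fock) : ‖V.rotateFun Ψ‖ₑ ^ 2 = ‖Ψ‖ₑ ^ 2 := by
  rw [enorm_sq_eq_tsum, enorm_sq_eq_tsum]
  refine tsum_congr fun n => ?_
  rw [← V.lintegral_act (stronglyMeasurable_wave Ψ n).measurable]
  refine lintegral_congr_ae ?_
  filter_upwards [V.wave_rotateFun Ψ n] with x hx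
  rw [hx]

/-- The second quantization of the unitary operator. -/
def rotate : Fock ≃ₗᵢ[ℂ] Fock where
  toFun := V.rotateFun
  invFun := V.inv.rotateFun
  map_add' Ψ Φ := by
    refine fock_ext fun n => ?_
    filter_upwards [V.wave_rotateFun (Ψ + Φ) n, V.wave_rotateFun Ψ n, V.wave_rotateFun Φ n,
      wave_add (V.rotateFun Ψ) (V.rotateFun Φ) n, V.act_congr_ae (wave_add Ψ Φ n)]
      with x h1 h2 h3 h4 h5
    rw [h1, h4, h2, h3, h5]
    simp only [act_apply, mul_add, Finset.sum_add_distrib]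
  map_smul' c Ψ := by
    refine fock_ext fun n => ?_
    filter_upwards [V.wave_rotateFun (c • Ψ) n, V.wave_rotateFun Ψ n,
      wave_smul c (V.rotateFun Ψ) n, V.act_congr_ae (wave_smul c Ψ n)] with x h1 h2 h3 h4
    rw [RingHom.id_apply, h1, h3, h2, h4]
    simp only [act_apply, Finset.mul_sum]
    exact Finset.sum_congr rfl fun μ _ => by ring
  left_inv Ψ := by
    refine fock_ext fun n => ?_
    refine (V.inv.wave_rotateFun _ n).trans ((V.inv.act_congr_ae (V.wave_rotateFun Ψ n)).trans ?_)
    rw [act_inv_act]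
  right_inv Ψ := by
    refine fock_ext fun n => ?_
    refine (V.wave_rotateFun _ n).trans ((V.act_congr_ae (V.inv.wave_rotateFun Ψ n)).trans ?_)
    rw [act_act_inv]
  norm_map' Ψ := by
    have h := V.enorm_rotateFun Ψ
    rw [← ofReal_norm, ← ofReal_norm, ← ENNReal.ofReal_pow (norm_nonneg _),
      ← ENNReal.ofReal_pow (norm_nonneg _),
      ENNReal.ofReal_eq_ofReal_iff (by positivity) (by positivity)] at h
    exact (pow_left_inj₀ (norm_nonneg _) (norm_nonneg _) two_ne_zero).1 h

theorem wave_rotate (Ψ : Fock) (n : ℕ) : wave (V.rotate Ψ) n =ᵐ[nMeasure n] V.act (wave Ψ n) :=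
  V.wave_rotateFun Ψ n

theorem rotate_symm : V.rotate.symm = V.inv.rotate := by
  ext1 Ψ
  rfl

/-- The independent `a` and `b` in `hv` make `v` blind to polarization, so the multiplication passes
through the mixing matrices. -/
theorem rotate_secondQuant {v v' : Photon → ℝ} (hv : ∀ k a b, v (V.T k, b) = v' (k, a))
    {Ψ Φ : Fock} (h : (Ψ, Φ) ∈ (secondQuant v).graph) :
    (V.rotate Ψ, V.rotate Φ) ∈ (secondQuant v').graph := by
  rw [mem_secondQuant_graph] at h ⊢
  intro n
  filter_upwards [V.wave_rotate Φ n, V.wave_rotate Ψ n, V.act_congr_ae (h n)] with x h1 h2 h3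
  rw [h1, h2, h3, act_apply, act_apply, Finset.mul_sum]
  refine Finset.sum_congr rfl fun μ _ => ?_
  have : ∀ i, v (config (fun i => V.T (x i).1) μ i) = v' (x i) := fun i => hv _ _ _
  simp only [this]
  ring

/-- Pointwise form of `Γ(u) a(g)* = a(u g)* Γ(u)`. -/
theorem act_creation {n : ℕ} (g : Photon → ℂ) (F : (Fin n → Photon) → ℂ) (c : ℂ)
    (x : Fin (n + 1) → Photon) :
    V.act (fun y => c * ∑ i : Fin (n + 1), g (y i) * F (y ∘ i.succAbove)) x
      = c * ∑ i : Fin (n + 1), (∑ b, V.w (x i).1 (x i).2 b * g (V.T (x i).1, b))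
          * V.act F (x ∘ i.succAbove) := by
  rw [act_apply]
  simp only [Finset.mul_sum]
  rw [Finset.sum_comm]
  refine Finset.sum_congr rfl fun i _ => ?_
  -- The polarization string splits into its entry at `i`, which rotates `g`, and the remaining
  -- entries, which rotate `F`.
  rw [← Equiv.sum_comp (Fin.insertNthEquiv (fun _ => Fin 2) i), Fintype.sum_prod_type,
    Finset.sum_mul, Finset.mul_sum]
  refine Finset.sum_congr rfl fun b _ => ?_
  rw [act_apply, Finset.mul_sum, Finset.mul_sum]
  refine Finset.sum_congr rfl fun μ _ => ?_
  have e : config (fun j => V.T (x j).1) (Fin.insertNthEquiv (fun _ => Fin 2) i (b, μ)) ∘ i.succAbove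
      = config (fun j => V.T ((x ∘ i.succAbove) j).1) μ := by
    funext j
    simp [config]
  rw [Fin.prod_univ_succAbove _ i]
  rw [e]
  simp [config]
  ring

theorem rotate_creation {g g' : Photon → ℂ}
    (hg : g' =ᵐ[photonMeasure] fun x => ∑ b, V.w x.1 x.2 b * g (V.T x.1, b))
    {Ψ Φ : Fock} (h : (Ψ, Φ) ∈ (creation g).graph) :
    (V.rotate Ψ, V.rotate Φ) ∈ (creation g').graph := by
  rw [creation_graph] at h ⊢
  obtain ⟨h0, h1⟩ := h
  constructor
  · filter_upwards [V.wave_rotate Φ 0, V.act_congr_ae h0] with x h2 h3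
    rw [h2, h3]
    simp [act_apply]
  · intro n
    filter_upwards [V.wave_rotate Φ (n + 1), V.act_congr_ae (h1 n),
      ae_all_iff.2 fun i => (quasiMeasurePreserving_succAbove i).ae (V.wave_rotate Ψ n),
      ae_all_iff.2 fun i : Fin (n + 1) => (quasiMeasurePreserving_apply i).ae hg] with x h2 h3 h4 h5
    rw [h2, h3, act_creation]
    simp only [h4, h5]

end PhotonRotation

/-! ### Graphs of sums of operators -/

section GraphAlgebra

variable {E F : Type*} [AddCommGroup E] [Module ℂ E] [AddCommGroup F] [Module ℂ F]

theorem exists_mem_graph {f : E →ₗ.[ℂ] F} {x : E} (hx : x ∈ f.domain) :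
    (x, f ⟨x, hx⟩) ∈ f.graph :=
  LinearPMap.mem_graph f ⟨x, hx⟩

theorem mem_graph_add {f g : E →ₗ.[ℂ] F} {x : E} {y : F} :
    (x, y) ∈ (f + g).graph ↔ ∃ a b, (x, a) ∈ f.graph ∧ (x, b) ∈ g.graph ∧ y = a + b := by
  constructor
  · intro h
    obtain ⟨⟨x', hf, hg⟩, h1, h2⟩ := (LinearPMap.mem_graph_iff _).1 h
    dsimp only at h1 h2
    subst h1 h2
    exact ⟨_, _, exists_mem_graph hf, exists_mem_graph hg, rfl⟩
  · rintro ⟨a, b, ha, hb, rfl⟩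
    obtain ⟨⟨x', hf⟩, h1, h2⟩ := (LinearPMap.mem_graph_iff _).1 ha
    dsimp only at h1 h2
    subst h1 h2
    obtain ⟨⟨x'', hg⟩, h1, h2⟩ := (LinearPMap.mem_graph_iff _).1 hb
    dsimp only at h1 h2
    subst h1 h2
    exact (LinearPMap.mem_graph_iff _).2 ⟨⟨x'', hf, hg⟩, rfl, rfl⟩

theorem mem_graph_neg {f : E →ₗ.[ℂ] F} {x : E} {y : F} :
    (x, y) ∈ (-f).graph ↔ (x, -y) ∈ f.graph := by
  constructor
  · intro h
    obtain ⟨⟨x', hf⟩, h1, h2⟩ := (LinearPMap.mem_graph_iff _).1 h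
    dsimp only at h1 h2
    subst h1 h2
    rw [LinearPMap.neg_apply, neg_neg]
    exact exists_mem_graph (f := f) hf
  · intro h
    obtain ⟨⟨x', hf⟩, h1, h2⟩ := (LinearPMap.mem_graph_iff _).1 h
    dsimp only at h1 h2
    subst h1
    exact (LinearPMap.mem_graph_iff _).2 ⟨⟨x', hf⟩, rfl, by
      rw [LinearPMap.neg_apply, h2, neg_neg]⟩

theorem mem_graph_sub {f g : E →ₗ.[ℂ] F} {x : E} {y : F} :
    (x, y) ∈ (f - g).graph ↔ ∃ a b, (x, a) ∈ f.graph ∧ (x, b) ∈ g.graph ∧ y = a - b := by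
  rw [sub_eq_add_neg, mem_graph_add]
  constructor
  · rintro ⟨a, b, ha, hb, rfl⟩
    exact ⟨a, -b, ha, mem_graph_neg.1 hb, by simp⟩
  · rintro ⟨a, b, ha, hb, rfl⟩
    exact ⟨a, -b, ha, mem_graph_neg.2 (by simpa using hb), by simp [sub_eq_add_neg]⟩

theorem mem_graph_smul {f : E →ₗ.[ℂ] F} {c : ℂ} {x : E} {y : F} :
    (x, y) ∈ (c • f).graph ↔ ∃ a, (x, a) ∈ f.graph ∧ y = c • a := by
  rw [LinearPMap.smul_graph]
  constructor
  · rintro ⟨⟨a, b⟩, h1, h2⟩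
    obtain ⟨rfl, rfl⟩ : a = x ∧ c • b = y := by simpa using h2
    exact ⟨b, h1, rfl⟩
  · rintro ⟨a, ha, rfl⟩
    exact ⟨(x, a), ha, by simp⟩

theorem mem_graph_compPMap {G : Type*} [AddCommGroup G] [Module ℂ G] {f : E →ₗ.[ℂ] F}
    {g : F →ₗ[ℂ] G} {x : E} {y : G} :
    (x, y) ∈ (g.compPMap f).graph ↔ ∃ a, (x, a) ∈ f.graph ∧ y = g a := by
  constructor
  · intro h
    obtain ⟨⟨x', hf⟩, h1, h2⟩ := (LinearPMap.mem_graph_iff _).1 h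
    dsimp only at h1 h2
    subst h1 h2
    exact ⟨_, exists_mem_graph (f := f) hf, rfl⟩
  · rintro ⟨a, ha, rfl⟩
    obtain ⟨⟨x', hf⟩, h1, h2⟩ := (LinearPMap.mem_graph_iff _).1 ha
    dsimp only at h1 h2
    subst h1 h2
    exact (LinearPMap.mem_graph_iff _).2 ⟨⟨x', hf⟩, rfl, rfl⟩

theorem mem_graph_toPMap_top {f : E →ₗ[ℂ] F} {x : E} {y : F} :
    (x, y) ∈ (f.toPMap ⊤).graph ↔ y = f x := by
  constructor
  · intro h
    obtain ⟨⟨x', hf⟩, h1, h2⟩ := (LinearPMap.mem_graph_iff _).1 h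
    dsimp only at h1 h2
    subst h1 h2
    rfl
  · rintro rfl
    exact (LinearPMap.mem_graph_iff _).2 ⟨⟨x, trivial⟩, rfl, rfl⟩

theorem mem_graph_sum_three {f : Fin 3 → E →ₗ.[ℂ] F} {x : E} {y : F} :
    (x, y) ∈ (∑ j, f j).graph ↔ ∃ a : Fin 3 → F, (∀ j, (x, a j) ∈ (f j).graph) ∧ y = ∑ j, a j := by
  rw [Fin.sum_univ_three, mem_graph_add]
  constructor
  · rintro ⟨a, b, ha, hb, rfl⟩
    obtain ⟨c, d, hc, hd, rfl⟩ := mem_graph_add.1 ha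
    refine ⟨![c, d, b], ?_, by simp [Fin.sum_univ_three]⟩
    intro j
    fin_cases j
    exacts [hc, hd, hb]
  · rintro ⟨a, ha, rfl⟩
    exact ⟨a 0 + a 1, a 2, mem_graph_add.2 ⟨_, _, ha 0, ha 1, rfl⟩, ha 2, Fin.sum_univ_three _⟩

end GraphAlgebra

theorem mem_graph_fockOp {T : Fock →ₗ.[ℂ] Fock} {Ψ Φ : SpinorFock} :
    (Ψ, Φ) ∈ (fockOp T).graph ↔ ∀ s, (Ψ s, Φ s) ∈ T.graph := by
  constructor
  · intro h s
    obtain ⟨⟨x', hf⟩, h1, h2⟩ := (LinearPMap.mem_graph_iff _).1 h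
    dsimp only at h1 h2
    subst h1 h2
    exact exists_mem_graph (hf s)
  · intro h
    refine (LinearPMap.mem_graph_iff _).2
      ⟨⟨Ψ, fun s => LinearPMap.mem_domain_of_mem_graph (h s)⟩, rfl, ?_⟩
    ext1 s
    exact LinearPMap.mem_graph_snd_inj _ (exists_mem_graph _) (h s) rfl

/-! ### Matrices acting on spinors -/

section Spinors

theorem matOp_apply (B : Matrix (Fin 4) (Fin 4) ℂ) (Ψ : SpinorFock) (s : Fin 4) :
    matOp B Ψ s = ∑ t, B s t • Ψ t := rfl

theorem matOp_matOp (A B : Matrix (Fin 4) (Fin 4) ℂ) (Ψ : SpinorFock) :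
    matOp A (matOp B Ψ) = matOp (A * B) Ψ := by
  ext1 s
  simp only [matOp_apply, Matrix.mul_apply, Finset.smul_sum, Finset.sum_smul, smul_smul]
  exact Finset.sum_comm

theorem matOp_one (Ψ : SpinorFock) : matOp 1 Ψ = Ψ := by
  ext1 s
  simp [matOp_apply, Matrix.one_apply]

theorem matOp_add (A B : Matrix (Fin 4) (Fin 4) ℂ) (Ψ : SpinorFock) :
    matOp (A + B) Ψ = matOp A Ψ + matOp B Ψ := by
  ext1 s
  simp [matOp_apply, add_smul, Finset.sum_add_distrib]

theorem matOp_smul (c : ℂ) (A : Matrix (Fin 4) (Fin 4) ℂ) (Ψ : SpinorFock) :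
    matOp (c • A) Ψ = c • matOp A Ψ := by
  ext1 s
  simp [matOp_apply, Finset.smul_sum, smul_smul]

theorem matOp_sum {ι : Type*} (u : Finset ι) (A : ι → Matrix (Fin 4) (Fin 4) ℂ) (Ψ : SpinorFock) :
    matOp (∑ i ∈ u, A i) Ψ = ∑ i ∈ u, matOp (A i) Ψ := by
  classical
  induction u using Finset.induction_on with
  | empty =>
    ext1 s
    simp [matOp_apply]
  | insert a u ha ih => rw [Finset.sum_insert ha, Finset.sum_insert ha, matOp_add, ih]

theorem inner_matOp_left (B : Matrix (Fin 4) (Fin 4) ℂ) (Ψ Φ : SpinorFock) :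
    inner ℂ (matOp B Ψ) Φ = inner ℂ Ψ (matOp B.conjTranspose Φ) := by
  simp only [PiLp.inner_apply, matOp_apply, sum_inner, inner_sum, inner_smul_left,
    inner_smul_right, Matrix.conjTranspose_apply]
  exact Finset.sum_comm

theorem inner_matOp_of_isHermitian {B : Matrix (Fin 4) (Fin 4) ℂ} (hB : B.IsHermitian)
    (Ψ Φ : SpinorFock) : inner ℂ (matOp B Ψ) Φ = inner ℂ Ψ (matOp B Φ) := by
  rw [inner_matOp_left, hB.eq]

/-- `matOp B` as a bounded operator. -/
def matCLM (B : Matrix (Fin 4) (Fin 4) ℂ) : SpinorFock →L[ℂ] SpinorFock where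
  toLinearMap := matOp B
  cont := by
    refine (PiLp.continuous_toLp 2 _).comp (continuous_pi fun s => ?_)
    exact continuous_finsetSum _ fun t _ => (PiLp.continuous_apply 2 _ t).const_smul (B s t)

theorem matCLM_apply (B : Matrix (Fin 4) (Fin 4) ℂ) (Ψ : SpinorFock) : matCLM B Ψ = matOp B Ψ := rfl

/-- A unitary matrix acting on spinors. -/
def matUnitary (S : Matrix (Fin 4) (Fin 4) ℂ) (hS : S.conjTranspose * S = 1) :
    SpinorFock ≃ₗᵢ[ℂ] SpinorFock where
  toFun := matOp S
  invFun := matOp S.conjTranspose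
  map_add' := map_add _
  map_smul' := map_smul _
  left_inv Ψ := by rw [matOp_matOp, hS, matOp_one]
  right_inv Ψ := by rw [matOp_matOp, mul_eq_one_comm.1 hS, matOp_one]
  norm_map' Ψ := by
    change ‖matOp S Ψ‖ = ‖Ψ‖
    have h : inner ℂ (matOp S Ψ) (matOp S Ψ) = inner ℂ Ψ Ψ := by
      rw [inner_matOp_left, matOp_matOp, hS, matOp_one]
    rw [norm_eq_sqrt_re_inner (𝕜 := ℂ), norm_eq_sqrt_re_inner (𝕜 := ℂ) Ψ, h]

/-- The operator `1 ⊗ U` for a unitary operator `U` on the Fock space. -/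
def fockUnitary (U : Fock ≃ₗᵢ[ℂ] Fock) : SpinorFock ≃ₗᵢ[ℂ] SpinorFock :=
  LinearIsometryEquiv.piLpCongrRight 2 fun _ => U

theorem fockUnitary_apply (U : Fock ≃ₗᵢ[ℂ] Fock) (Ψ : SpinorFock) (s : Fin 4) :
    fockUnitary U Ψ s = U (Ψ s) := rfl

theorem fockUnitary_matOp (U : Fock ≃ₗᵢ[ℂ] Fock) (B : Matrix (Fin 4) (Fin 4) ℂ) (Ψ : SpinorFock) :
    fockUnitary U (matOp B Ψ) = matOp B (fockUnitary U Ψ) := by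
  ext1 s
  simp only [fockUnitary_apply, matOp_apply, map_sum, map_smul]

theorem matOp_mem_graph {T : Fock →ₗ.[ℂ] Fock} {Ψ Φ : SpinorFock}
    (h : ∀ s, (Ψ s, Φ s) ∈ T.graph) (B : Matrix (Fin 4) (Fin 4) ℂ) (s : Fin 4) :
    (matOp B Ψ s, matOp B Φ s) ∈ T.graph := by
  have : (matOp B Ψ s, matOp B Φ s) = ∑ t, B s t • (Ψ t, Φ t) := by
    simp only [Prod.smul_mk, matOp_apply]
    ext1
    · rw [Prod.fst_sum]
    · rw [Prod.snd_sum]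
  rw [this]
  exact Submodule.sum_mem _ fun t _ => Submodule.smul_mem _ _ (h t)

end Spinors

/-! ### Dirac matrices -/

theorem mul_left_anticomm {R : Type*} [Ring R] {a b : R} (h : a * b = -(b * a)) (x : R) :
    a * (b * x) = -(b * (a * x)) := by
  rw [← mul_assoc, h, neg_mul, mul_assoc]

namespace DiracMatrices

variable (D : DiracMatrices)

theorem α_sq (j : Fin 3) : D.α j * D.α j = 1 := by
  have h := D.α_anticomm j j
  rw [if_pos rfl, ← two_mul] at h
  have h2 : (2 : ℂ) • (D.α j * D.α j) = (2 : ℂ) • 1 := by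
    rw [two_smul, ← two_mul, h, two_smul, one_add_one_eq_two]
  exact smul_right_injective _ (two_ne_zero (α := ℂ)) h2

theorem α_mul_comm {j l : Fin 3} (h : j ≠ l) : D.α j * D.α l = -(D.α l * D.α j) := by
  have := D.α_anticomm j l
  rw [if_neg h] at this
  exact eq_neg_of_add_eq_zero_left this

theorem α_mul_β (j : Fin 3) : D.α j * D.β = -(D.β * D.α j) :=
  eq_neg_of_add_eq_zero_left (D.αβ_anticomm j)

/-- `α · v`. -/
def slash (v : R3) : Matrix (Fin 4) (Fin 4) ℂ := ∑ j, (v j : ℂ) • D.α j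

theorem slash_isHermitian (v : R3) : (D.slash v).IsHermitian := by
  simp only [Matrix.IsHermitian, slash, Matrix.conjTranspose_sum, Matrix.conjTranspose_smul,
    (D.α_hermitian _).eq, RCLike.star_def, Complex.conj_ofReal]

theorem α_mul_slash (v : R3) (l : Fin 3) :
    D.α l * D.slash v + D.slash v * D.α l = (2 * (v l : ℂ)) • 1 := by
  simp only [slash, Finset.mul_sum, Finset.sum_mul, ← Finset.sum_add_distrib, mul_smul_comm,
    smul_mul_assoc, ← smul_add, D.α_anticomm, smul_ite, smul_zero, Finset.sum_ite_eq,
    Finset.mem_univ, if_true]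
  rw [mul_comm, mul_smul, two_smul, one_add_one_eq_two]

theorem slash_sq {v : R3} (hv : ‖v‖ = 1) : D.slash v * D.slash v = 1 := by
  have h : (2 : ℂ) • (D.slash v * D.slash v) = (2 : ℂ) • 1 := by
    -- Contracting the anticommutator of `α l` and `α·v` with `v` yields `2 (α·v)²` on one side and
    -- `2 ‖v‖²` on the other.
    have h1 : ∑ l, (v l : ℂ) • (D.α l * D.slash v + D.slash v * D.α l)
        = (2 : ℂ) • (D.slash v * D.slash v) := by
      have h2 : ∑ l, (v l : ℂ) • (D.α l * D.slash v) = D.slash v * D.slash v := by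
        simp only [← smul_mul_assoc, ← Finset.sum_mul]
        rfl
      have h3 : ∑ l, (v l : ℂ) • (D.slash v * D.α l) = D.slash v * D.slash v := by
        simp only [← mul_smul_comm, ← Finset.mul_sum]
        rfl
      rw [two_smul]
      simp only [smul_add, Finset.sum_add_distrib, h2, h3]
    rw [← h1]
    simp only [α_mul_slash, smul_smul, ← Finset.sum_smul]
    congr 1
    have h2 : ∑ l, v l ^ 2 = 1 := by
      have := EuclideanSpace.real_norm_sq_eq v
      rw [← this, hv, one_pow]
    have h3 : ∑ l, (v l : ℂ) ^ 2 = 1 := by exact_mod_cast h2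
    calc ∑ l, (v l : ℂ) * (2 * (v l : ℂ)) = 2 * ∑ l, (v l : ℂ) ^ 2 := by
          rw [Finset.mul_sum]
          exact Finset.sum_congr rfl fun l _ => by ring
      _ = 2 := by rw [h3, mul_one]
  exact smul_right_injective _ (two_ne_zero (α := ℂ)) h

theorem slash_mul_β (v : R3) : D.slash v * D.β = -(D.β * D.slash v) := by
  simp only [slash, Finset.mul_sum, Finset.sum_mul, mul_smul_comm, smul_mul_assoc, D.α_mul_β,
    smul_neg, Finset.sum_neg_distrib]

/-- The pseudoscalar `α₁ α₂ α₃`. -/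
def pseudoscalar : Matrix (Fin 4) (Fin 4) ℂ := D.α 0 * D.α 1 * D.α 2

/-- Each `α j` anticommutes with two of the three factors and commutes with itself, so the signs
cancel. Against `β` there are three sign changes, and the product anticommutes. -/
theorem pseudoscalar_mul_α (j : Fin 3) : D.pseudoscalar * D.α j = D.α j * D.pseudoscalar := by
  have h10 := D.α_mul_comm (j := 1) (l := 0) (by decide)
  have h20 := D.α_mul_comm (j := 2) (l := 0) (by decide)
  have h21 := D.α_mul_comm (j := 2) (l := 1) (by decide)
  unfold pseudoscalar
  fin_cases j <;> simp only [Fin.zero_eta, Fin.mk_one, Fin.reduceFinMk, mul_assoc, h20, h21,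
    mul_left_anticomm h10, mul_left_anticomm h20, mul_left_anticomm h21, mul_neg, neg_neg]

theorem pseudoscalar_mul_slash (v : R3) :
    D.pseudoscalar * D.slash v = D.slash v * D.pseudoscalar := by
  simp only [slash, Finset.mul_sum, Finset.sum_mul, mul_smul_comm, smul_mul_assoc,
    pseudoscalar_mul_α]

theorem pseudoscalar_mul_β : D.pseudoscalar * D.β = -(D.β * D.pseudoscalar) := by
  have h0 := D.α_mul_β 0
  have h1 := D.α_mul_β 1
  have h2 := D.α_mul_β 2
  simp only [pseudoscalar, mul_assoc, h2, mul_left_anticomm h0, mul_left_anticomm h1,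
    mul_neg, neg_neg]

theorem conjTranspose_pseudoscalar_mul : D.pseudoscalar.conjTranspose * D.pseudoscalar = 1 := by
  have h0 := D.α_sq 0
  have h1 := D.α_sq 1
  have h2 := D.α_sq 2
  simp only [pseudoscalar, Matrix.conjTranspose_mul, (D.α_hermitian _).eq]
  rw [mul_assoc (D.α 0), mul_assoc (D.α 2), mul_assoc (D.α 1), ← mul_assoc (D.α 0) (D.α 0), h0,
    one_mul, ← mul_assoc (D.α 1), h1, one_mul, h2]

/-- The spinor representation of the half-turn around the axis `v`. -/
def halfTurn (v : R3) : Matrix (Fin 4) (Fin 4) ℂ := D.slash v * D.pseudoscalar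

theorem conjTranspose_halfTurn_mul {v : R3} (hv : ‖v‖ = 1) :
    (D.halfTurn v).conjTranspose * D.halfTurn v = 1 := by
  rw [halfTurn, Matrix.conjTranspose_mul, (D.slash_isHermitian v).eq, Matrix.mul_assoc,
    ← Matrix.mul_assoc (D.slash v), D.slash_sq hv, Matrix.one_mul,
    D.conjTranspose_pseudoscalar_mul]

/-- This is the purpose of the pseudoscalar: `α·v` alone would reverse the mass term, and the second
anticommuting factor restores it. -/
theorem halfTurn_mul_β (v : R3) : D.halfTurn v * D.β = D.β * D.halfTurn v := by
  rw [halfTurn, Matrix.mul_assoc, D.pseudoscalar_mul_β, Matrix.mul_neg, ← Matrix.mul_assoc,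
    D.slash_mul_β, Matrix.neg_mul, neg_neg, Matrix.mul_assoc]

/-- Conjugation by the half-turn matrix sends `α l` to `2 v_l (α·v) - α l`, the half-turn of the
vector `α`. -/
theorem α_mul_halfTurn {v : R3} (hv : ‖v‖ = 1) (l : Fin 3) :
    D.α l * D.halfTurn v = (2 * (v l : ℂ)) • (D.halfTurn v * D.slash v) - D.halfTurn v * D.α l := by
  have h1 : D.halfTurn v * D.slash v = D.pseudoscalar := by
    rw [halfTurn, Matrix.mul_assoc, D.pseudoscalar_mul_slash, ← Matrix.mul_assoc, D.slash_sq hv,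
      Matrix.one_mul]
  rw [h1, halfTurn, Matrix.mul_assoc (D.slash v), D.pseudoscalar_mul_α, ← Matrix.mul_assoc,
    ← Matrix.mul_assoc, eq_sub_iff_add_eq, ← Matrix.add_mul, D.α_mul_slash, smul_mul_assoc,
    Matrix.one_mul]

end DiracMatrices

/-! ### The Hamiltonian -/

section Hamiltonian

/-- The regularized photon energy `ω_m(k) = (1 + m)|k| + m`. -/
def photonEnergy (m : ℝ) : Photon → ℝ := fun x => (1 + m) * ‖x.1‖ + m

theorem mem_hamiltonian_graph {D : DiracMatrices} {e : Fin 2 → R3 → R3} {ρ : R3 → ℂ} {M q m : ℝ}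
    {p : R3} {Ψ Φ : SpinorFock} :
    (Ψ, Φ) ∈ (hamiltonian D e ρ M q m p).graph ↔
      ∃ (X : SpinorFock) (Y Z : Fin 3 → SpinorFock),
        (∀ s, (Ψ s, X s) ∈ (secondQuant (photonEnergy m)).graph) ∧
        (∀ j s, (Ψ s, Y j s) ∈ (secondQuant fun x => x.1 j).graph) ∧
        (∀ j s, (Ψ s, Z j s) ∈ (segalField (coupling ρ e j)).graph) ∧
        Φ = matOp (D.slash p + (M : ℂ) • D.β) Ψ + X - ∑ j, matOp (D.α j) (Y j)
          - (q : ℂ) • ∑ j, matOp (D.α j) (Z j) := by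
  unfold hamiltonian
  constructor
  · intro h
    obtain ⟨a, b, ha, hb, rfl⟩ := mem_graph_sub.1 h
    obtain ⟨c, d, hc, hd, rfl⟩ := mem_graph_sub.1 ha
    obtain ⟨u, X, hu, hX, rfl⟩ := mem_graph_add.1 hc
    obtain ⟨v, hv, rfl⟩ := mem_graph_smul.1 hb
    obtain ⟨y, hy, rfl⟩ := mem_graph_sum_three.1 hd
    obtain ⟨z, hz, rfl⟩ := mem_graph_sum_three.1 hv
    choose Y hY hY' using fun j => mem_graph_compPMap.1 (hy j)
    choose Z hZ hZ' using fun j => mem_graph_compPMap.1 (hz j)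
    refine ⟨X, Y, Z, mem_graph_fockOp.1 hX, fun j => mem_graph_fockOp.1 (hY j),
      fun j => mem_graph_fockOp.1 (hZ j), ?_⟩
    rw [mem_graph_toPMap_top.1 hu]
    simp only [hY', hZ']
    rfl
  · rintro ⟨X, Y, Z, hX, hY, hZ, rfl⟩
    refine mem_graph_sub.2 ⟨_, _, mem_graph_sub.2 ⟨_, _, mem_graph_add.2
      ⟨_, _, mem_graph_toPMap_top.2 rfl, mem_graph_fockOp.2 hX, rfl⟩, mem_graph_sum_three.2
      ⟨_, fun j => mem_graph_compPMap.2 ⟨_, mem_graph_fockOp.2 (hY j), rfl⟩, rfl⟩, rfl⟩,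
      mem_graph_smul.2 ⟨_, mem_graph_sum_three.2
      ⟨_, fun j => mem_graph_compPMap.2 ⟨_, mem_graph_fockOp.2 (hZ j), rfl⟩, rfl⟩, rfl⟩, rfl⟩

end Hamiltonian

/-! ### Domain, symmetry and rotation of the Hamiltonian -/

section Domain

theorem measurable_photonEnergy (m : ℝ) : Measurable (photonEnergy m) := by
  unfold photonEnergy
  fun_prop

/-- Here `m ≥ 0` enters. Domination of `|k|` puts the domain of `dΓ(ω_m)` inside the domains of the
momentum and field terms. -/
theorem norm_le_photonEnergy {m : ℝ} (hm : 0 ≤ m) (x : Photon) : ‖x.1‖ ≤ photonEnergy m x := by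
  have := mul_nonneg hm (norm_nonneg x.1)
  simp only [photonEnergy]
  linarith

theorem photonEnergy_nonneg {m : ℝ} (hm : 0 ≤ m) (x : Photon) : 0 ≤ photonEnergy m x :=
  (norm_nonneg _).trans (norm_le_photonEnergy hm x)

theorem exists_secondQuant_of_abs_le {v w : Photon → ℝ} (hv : Measurable v)
    (hvw : ∀ x, |v x| ≤ w x) {Ψ : Fock} (hΨ : Ψ ∈ (secondQuant w).domain) :
    ∃ Φ, (Ψ, Φ) ∈ (secondQuant v).graph := by
  obtain ⟨X, hX⟩ := LinearPMap.mem_domain_iff.1 hΨ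
  rw [mem_secondQuant_graph] at hX
  obtain ⟨Φ, hΦ⟩ := exists_wave_ae_eq (fun n x => ((∑ i, v (x i) : ℝ) : ℂ) * wave Ψ n x)
    (fun n => by
      refine AEStronglyMeasurable.mul (Measurable.aestronglyMeasurable ?_)
        (stronglyMeasurable_wave Ψ n).aestronglyMeasurable
      exact Complex.measurable_ofReal.comp
        (Finset.measurable_sum _ fun i _ => hv.comp (measurable_pi_apply i)))
    (fun n σ => by
      filter_upwards [wave_comp_perm Ψ σ] with x hx
      rw [hx, sum_comp_perm])
    (by
      refine ne_top_of_le_ne_top (b := ‖X‖ₑ ^ 2) (by simp) ?_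
      rw [enorm_sq_eq_tsum]
      refine ENNReal.tsum_le_tsum fun n => lintegral_mono_ae ?_
      filter_upwards [hX n] with x hx
      rw [hx, enorm_mul, enorm_mul]
      gcongr
      rw [← ofReal_norm, ← ofReal_norm, Complex.norm_real, Complex.norm_real]
      refine ENNReal.ofReal_le_ofReal ?_
      refine (Finset.abs_sum_le_sum_abs _ _).trans ?_
      exact (Finset.sum_le_sum fun i _ => hvw (x i)).trans (le_abs_self _))
  exact ⟨Φ, mem_secondQuant_graph.2 hΦ⟩

theorem exists_secondQuant_coord {m : ℝ} (hm : 0 ≤ m) (j : Fin 3) {Ψ : Fock}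
    (hΨ : Ψ ∈ (secondQuant (photonEnergy m)).domain) :
    ∃ Φ, (Ψ, Φ) ∈ (secondQuant fun x => x.1 j).graph :=
  exists_secondQuant_of_abs_le (by fun_prop)
    (fun x => (PiLp.norm_apply_le x.1 j).trans (norm_le_photonEnergy hm x)) hΨ

variable {w : Photon → ℝ} {g h : Photon → ℂ}

theorem IsFormFactor.segalField_symm (hf : IsFormFactor w g h) {Ψ Φ Z Z' : Fock}
    (hΨ : Ψ ∈ (secondQuant w).domain) (hΦ : Φ ∈ (secondQuant w).domain)
    (hZ : (Ψ, Z) ∈ (segalField g).graph) (hZ' : (Φ, Z') ∈ (segalField g).graph) :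
    inner ℂ Z Φ = inner ℂ Ψ Z' := by
  obtain ⟨a, c, h1, h2, h3⟩ := hf.exists_segalField hΨ
  obtain ⟨a', c', h1', h2', h3'⟩ := hf.exists_segalField hΦ
  rw [LinearPMap.mem_graph_snd_inj _ hZ h3 rfl, LinearPMap.mem_graph_snd_inj _ hZ' h3' rfl]
  have e1 := h2 Φ c' h1'
  have e2 : inner ℂ c Φ = inner ℂ Ψ a' := by
    rw [← inner_conj_symm, ← h2' Ψ c h1, inner_conj_symm]
  rw [inner_smul_left, inner_smul_right, Complex.conj_ofReal, inner_add_left, inner_add_right,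
    e1, e2, add_comm]

theorem creation_linear {ι : Type*} [Fintype ι] {g : ι → Photon → ℂ} {Ψ : Fock} {c : ι → Fock}
    (hc : ∀ l, (Ψ, c l) ∈ (creation (g l)).graph) (r : ι → ℂ) :
    (Ψ, ∑ l, r l • c l) ∈ (creation fun x => ∑ l, r l * g l x).graph := by
  have hsum : ∀ (n : ℕ) (s : Finset ι), wave (∑ l ∈ s, r l • c l) n
      =ᵐ[nMeasure n] fun x => ∑ l ∈ s, r l * wave (c l) n x := by
    classical
    intro n s
    induction s using Finset.induction_on with
    | empty => simpa using wave_zero n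
    | insert a s ha ih =>
      rw [Finset.sum_insert ha]
      filter_upwards [wave_add (r a • c a) (∑ l ∈ s, r l • c l) n, wave_smul (r a) (c a) n, ih]
        with x h1 h2 h3
      rw [h1, h2, h3, Finset.sum_insert ha]
  have hc' := hc
  simp only [creation_graph] at hc'
  refine mem_creation_graph_of_wave fun n => ?_
  cases n with
  | zero =>
    filter_upwards [hsum 0 Finset.univ, ae_all_iff.2 fun l => (hc' l).1] with x h1 h2
    rw [h1]
    simp [h2, creationWave]
  | succ n =>
    filter_upwards [hsum (n + 1) Finset.univ, ae_all_iff.2 fun l => (hc' l).2 n] with x h1 h2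
    rw [h1]
    simp only [h2, creationWave, Finset.mul_sum, Finset.sum_mul]
    rw [Finset.sum_comm]
    exact Finset.sum_congr rfl fun i _ => Finset.sum_congr rfl fun l _ => by ring

/-- Field operators are transformed like their form factors. -/
theorem PhotonRotation.exists_rotate_segalField (V : PhotonRotation) {ι : Type*} [Fintype ι]
    {g h : ι → Photon → ℂ} (hf : ∀ l, IsFormFactor w (g l) (h l))
    (hw : ∀ k a b, w (V.T k, b) = w (k, a)) (r : ι → ι → ℝ)
    (hg : ∀ j, (fun x => ∑ l, (r j l : ℂ) * g l x)
      =ᵐ[photonMeasure] fun x => ∑ b, V.w x.1 x.2 b * g j (V.T x.1, b))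
    {Ψ : Fock} (hΨ : Ψ ∈ (secondQuant w).domain) {Z : ι → Fock}
    (hZ : ∀ j, (Ψ, Z j) ∈ (segalField (g j)).graph) :
    ∃ Z' : ι → Fock, (∀ l, (V.rotate Ψ, Z' l) ∈ (segalField (g l)).graph) ∧
      ∀ j, V.rotate (Z j) = ∑ l, (r j l : ℂ) • Z' l := by
  have hdom : ∀ {Φ : Fock}, Φ ∈ (secondQuant w).domain → V.rotate Φ ∈ (secondQuant w).domain := by
    intro Φ hΦ
    obtain ⟨X, hX⟩ := LinearPMap.mem_domain_iff.1 hΦ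
    exact LinearPMap.mem_domain_of_mem_graph (V.rotate_secondQuant hw hX)
  choose a c hc ha hs using fun j => (hf j).exists_segalField hΨ
  choose a' c' hc' ha' hs' using fun j => (hf j).exists_segalField (hdom hΨ)
  refine ⟨_, hs', fun j => ?_⟩
  rw [LinearPMap.mem_graph_snd_inj _ (hZ j) (hs j) rfl]
  have hcr : ∀ {Φ d : Fock} {d' : ι → Fock}, (Φ, d) ∈ (creation (g j)).graph →
      (∀ l, (V.rotate Φ, d' l) ∈ (creation (g l)).graph) →
      V.rotate d = ∑ l, (r j l : ℂ) • d' l := fun hd hd' =>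
    LinearPMap.mem_graph_snd_inj _ (V.rotate_creation (hg j) hd) (creation_linear hd' _) rfl
  -- Annihilation operators transform by duality: both sides are tested against the dense set of
  -- rotated domain vectors. Since `a(g)` is antilinear in `g`, the coefficients `r` have to be real
  -- for both parts of the field to transform alike.
  have hann : V.rotate (a j) = ∑ l, (r j l : ℂ) • a' l := by
    have hdense := dense_secondQuant_domain (hf j).measurable_weight (hf j).weight_nonneg
    have hdense' : Dense (V.rotate '' ((secondQuant w).domain : Set Fock)) :=
      V.rotate.surjective.denseRange.dense_image V.rotate.continuous hdense
    refine hdense'.eq_of_inner_left (𝕜 := ℂ) ?_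
    rintro _ ⟨Φ, hΦ, rfl⟩
    obtain ⟨d, hd⟩ := (hf j).exists_creation hΦ
    choose d' hd' using fun l => (hf l).exists_creation (hdom hΦ)
    rw [LinearIsometryEquiv.inner_map_map, ha j Φ d hd, ← V.rotate.inner_map_map, hcr hd hd',
      sum_inner, inner_sum]
    refine Finset.sum_congr rfl fun l _ => ?_
    rw [inner_smul_left, inner_smul_right, ha' l _ _ (hd' l), Complex.conj_ofReal]
  rw [map_smul, map_add, hann, hcr (hc j) hc', ← Finset.sum_add_distrib, Finset.smul_sum]
  refine Finset.sum_congr rfl fun l _ => ?_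
  rw [← smul_add, smul_comm]

end Domain

/-! ### Symmetry, common domain and momentum dependence of the Hamiltonian -/

section Symmetry

theorem inner_spinor_of_forall {Ψ Φ X X' : SpinorFock}
    (h : ∀ s t, inner ℂ (X s) (Φ t) = inner ℂ (Ψ s) (X' t)) :
    inner ℂ X Φ = inner ℂ Ψ X' := by
  simp only [PiLp.inner_apply, h]

theorem inner_matOp_of_forall {B : Matrix (Fin 4) (Fin 4) ℂ} (hB : B.IsHermitian)
    {Ψ Φ X X' : SpinorFock} (h : ∀ s t, inner ℂ (X s) (Φ t) = inner ℂ (Ψ s) (X' t)) :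
    inner ℂ (matOp B X) Φ = inner ℂ Ψ (matOp B X') := by
  rw [← inner_matOp_of_isHermitian hB]
  simp only [PiLp.inner_apply, matOp_apply, sum_inner, inner_smul_left, h]

variable {D : DiracMatrices} {e : Fin 2 → R3 → R3} {ρ : R3 → ℂ} {M q m : ℝ}
  {h : Fin 3 → Photon → ℂ}

theorem hamiltonian_symm (hf : ∀ j, IsFormFactor (photonEnergy m) (coupling ρ e j) (h j))
    (p : R3) : IsSymmetricOp (hamiltonian D e ρ M q m p) := by
  intro Ψ Φ Ψ' Φ' h1 h2
  obtain ⟨X, Y, Z, hX, hY, hZ, rfl⟩ := mem_hamiltonian_graph.1 h1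
  obtain ⟨X', Y', Z', hX', hY', hZ', rfl⟩ := mem_hamiltonian_graph.1 h2
  have e1 := inner_matOp_of_isHermitian (B := D.slash p + (M : ℂ) • D.β)
    ((D.slash_isHermitian p).add (by
      rw [Matrix.IsHermitian, Matrix.conjTranspose_smul, D.β_hermitian.eq, RCLike.star_def,
        Complex.conj_ofReal])) Ψ Ψ'
  have e2 : inner ℂ X Ψ' = inner ℂ Ψ X' :=
    inner_spinor_of_forall fun s t => secondQuant_symm _ _ _ _ (hX s) (hX' t)
  have e3 : ∀ j, inner ℂ (matOp (D.α j) (Y j)) Ψ' = inner ℂ Ψ (matOp (D.α j) (Y' j)) := fun j =>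
    inner_matOp_of_forall (D.α_hermitian j) fun s t =>
      secondQuant_symm _ _ _ _ (hY j s) (hY' j t)
  have e4 : ∀ j, inner ℂ (matOp (D.α j) (Z j)) Ψ' = inner ℂ Ψ (matOp (D.α j) (Z' j)) := fun j =>
    inner_matOp_of_forall (D.α_hermitian j) fun s t => (hf j).segalField_symm
      (LinearPMap.mem_domain_of_mem_graph (hX s)) (LinearPMap.mem_domain_of_mem_graph (hX' t))
      (hZ j s) (hZ' j t)
  simp only [inner_sub_left, inner_sub_right, inner_add_left, inner_add_right, inner_smul_left,
    inner_smul_right, sum_inner, inner_sum, e1, e2, e3, e4, Complex.conj_ofReal]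

/-- The photon energy alone decides the domain. -/
theorem exists_mem_hamiltonian_graph (hm : 0 ≤ m)
    (hf : ∀ j, IsFormFactor (photonEnergy m) (coupling ρ e j) (h j)) (p : R3) {Ψ : SpinorFock}
    (hΨ : ∀ s, Ψ s ∈ (secondQuant (photonEnergy m)).domain) :
    ∃ Φ, (Ψ, Φ) ∈ (hamiltonian D e ρ M q m p).graph := by
  choose X hX using fun s => LinearPMap.mem_domain_iff.1 (hΨ s)
  choose Y hY using fun j s => exists_secondQuant_coord hm j (hΨ s)
  choose a c _ _ hZ using fun j s => (hf j).exists_segalField (hΨ s)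
  exact ⟨_, mem_hamiltonian_graph.2 ⟨WithLp.toLp 2 X, fun j => WithLp.toLp 2 (Y j),
    fun j => WithLp.toLp 2 fun s => _, hX, hY, hZ, rfl⟩⟩

/-- The total momentum occurs only in the bounded matrix `α·p`, so the domain is the same for all
`p`. -/
theorem hamiltonian_graph_shift (p p' : R3) (Ψ Φ : SpinorFock) :
    (Ψ, Φ) ∈ (hamiltonian D e ρ M q m p).graph ↔
      (Ψ, Φ + matCLM (D.slash (p' - p)) Ψ) ∈ (hamiltonian D e ρ M q m p').graph := by
  have key : ∀ p p' : R3, ∀ Φ : SpinorFock, (Ψ, Φ) ∈ (hamiltonian D e ρ M q m p).graph →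
      (Ψ, Φ + matCLM (D.slash (p' - p)) Ψ) ∈ (hamiltonian D e ρ M q m p').graph := by
    intro p p' Φ hΦ
    obtain ⟨X, Y, Z, hX, hY, hZ, rfl⟩ := mem_hamiltonian_graph.1 hΦ
    refine mem_hamiltonian_graph.2 ⟨X, Y, Z, hX, hY, hZ, ?_⟩
    have e1 : D.slash p' = D.slash p + D.slash (p' - p) := by
      simp [DiracMatrices.slash, sub_smul]
    rw [e1, matCLM_apply]
    simp only [matOp_add]
    abel
  refine ⟨key p p' Φ, fun hΦ => ?_⟩
  have := key p' p _ hΦ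
  have e2 : D.slash (p - p') = -D.slash (p' - p) := by
    simp [DiracMatrices.slash, sub_smul]
  rw [e2, matCLM_apply, matCLM_apply] at this
  have e3 : Φ + matOp (D.slash (p' - p)) Ψ + matOp (-D.slash (p' - p)) Ψ = Φ := by
    rw [add_assoc, ← matOp_add, add_neg_cancel]
    have : matOp 0 Ψ = 0 := by
      ext1 s
      simp [matOp_apply]
    rw [this, add_zero]
  rwa [e3] at this

end Symmetry

/-! ### Rotation covariance of the Hamiltonian -/

section Rotation

variable {D : DiracMatrices} {e : Fin 2 → R3 → R3} {ρ : R3 → ℂ} {M q m : ℝ}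
  {h : Fin 3 → Photon → ℂ}

/-- The contraction of two vectors is invariant: the matrix `r` produced by rotating `Y` is absorbed
by moving `S` past the `α j`. -/
theorem matOp_vector_transform {S : Matrix (Fin 4) (Fin 4) ℂ} {r : Fin 3 → Fin 3 → ℝ}
    (hα : ∀ l, ∑ j, (r j l : ℂ) • (S * D.α j) = D.α l * S) (U : Fock ≃ₗᵢ[ℂ] Fock)
    {Y Y' : Fin 3 → SpinorFock} (hY : ∀ j, fockUnitary U (Y j) = ∑ l, (r j l : ℂ) • Y' l) :
    matOp S (fockUnitary U (∑ j, matOp (D.α j) (Y j))) = ∑ l, matOp (D.α l) (matOp S (Y' l)) := by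
  simp only [map_sum, fockUnitary_matOp, hY, matOp_matOp, map_smul, ← hα, matOp_sum, matOp_smul]
  exact Finset.sum_comm

/-- A simultaneous rotation of spinors and photons, with matrix `r`, maps the Hamiltonian at
total momentum `r p'` to the Hamiltonian at total momentum `p'`. -/
theorem rotate_hamiltonian_graph (hm : 0 ≤ m)
    (hf : ∀ j, IsFormFactor (photonEnergy m) (coupling ρ e j) (h j)) (V : PhotonRotation)
    {S : Matrix (Fin 4) (Fin 4) ℂ} {r : Fin 3 → Fin 3 → ℝ}
    (hα : ∀ l, ∑ j, (r j l : ℂ) • (S * D.α j) = D.α l * S) (hβ : S * D.β = D.β * S)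
    (hr : ∀ k j, V.T k j = ∑ l, r j l * k l)
    (hg : ∀ j, (fun x => ∑ l, (r j l : ℂ) * coupling ρ e l x)
      =ᵐ[photonMeasure] fun x => ∑ b, V.w x.1 x.2 b * coupling ρ e j (V.T x.1, b))
    {p : R3} {Ψ Φ : SpinorFock} (hΨ : (Ψ, Φ) ∈ (hamiltonian D e ρ M q m (V.T p)).graph) :
    (matOp S (fockUnitary V.rotate Ψ), matOp S (fockUnitary V.rotate Φ))
      ∈ (hamiltonian D e ρ M q m p).graph := by
  have hω : ∀ k (a b : Fin 2), photonEnergy m (V.T k, b) = photonEnergy m (k, a) := fun k a b => by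
    simp [photonEnergy]
  obtain ⟨X, Y, Z, hX, hY, hZ, rfl⟩ := mem_hamiltonian_graph.1 hΨ
  have hΨd : ∀ s, Ψ s ∈ (secondQuant (photonEnergy m)).domain := fun s =>
    LinearPMap.mem_domain_of_mem_graph (hX s)
  have hX' : ∀ s, (fockUnitary V.rotate Ψ s, fockUnitary V.rotate X s)
      ∈ (secondQuant (photonEnergy m)).graph := fun s => V.rotate_secondQuant hω (hX s)
  choose Y' hY' using fun l s => exists_secondQuant_coord hm l
    (LinearPMap.mem_domain_of_mem_graph (hX' s))
  choose Z' hZ' hZr using fun s => V.exists_rotate_segalField hf hω r hg (hΨd s)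
    (Z := fun j => Z j s) fun j => hZ j s
  -- The rotated momentum operator multiplies by `(T k)_j = ∑ r_jl k_l`, summed over the photons.
  have hYr : ∀ j, fockUnitary V.rotate (Y j) = ∑ l, (r j l : ℂ) • WithLp.toLp 2 (Y' l) := by
    intro j
    ext1 s
    have h1 := V.rotate_secondQuant (v' := fun x => V.T x.1 j) (fun _ _ _ => rfl) (hY j s)
    rw [mem_secondQuant_graph] at h1
    have h2 := fun l => mem_secondQuant_graph.1 (hY' l s)
    have h3 : (∑ l, (r j l : ℂ) • WithLp.toLp 2 (Y' l) : SpinorFock) s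
        = (r j 0 : ℂ) • Y' 0 s + (r j 1 : ℂ) • Y' 1 s + (r j 2 : ℂ) • Y' 2 s := by
      rw [Fin.sum_univ_three]
      rfl
    rw [h3]
    refine fock_ext fun n => ?_
    filter_upwards [h1 n, ae_all_iff.2 fun l => h2 l n, ae_all_iff.2 fun l =>
      wave_smul (r j l : ℂ) (Y' l s) n, wave_add ((r j 0 : ℂ) • Y' 0 s + (r j 1 : ℂ) • Y' 1 s)
        ((r j 2 : ℂ) • Y' 2 s) n, wave_add ((r j 0 : ℂ) • Y' 0 s) ((r j 1 : ℂ) • Y' 1 s) n]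
      with x k1 k2 k3 k4 k5
    rw [k4, k5, k3, k3, k3, k2, k2, k2]
    refine k1.trans ?_
    simp only [hr, Fin.sum_univ_three, Finset.sum_add_distrib, ← Finset.mul_sum, fockUnitary_apply]
    push_cast
    ring
  have hZr' : ∀ j, fockUnitary V.rotate (Z j)
      = ∑ l, (r j l : ℂ) • (WithLp.toLp 2 fun s => Z' s l : SpinorFock) := by
    intro j
    ext1 s
    refine (hZr s j).trans ?_
    rw [Fin.sum_univ_three, Fin.sum_univ_three]
    rfl
  refine mem_hamiltonian_graph.2 ⟨matOp S (fockUnitary V.rotate X),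
    fun l => matOp S (WithLp.toLp 2 (Y' l)), fun l => matOp S (WithLp.toLp 2 fun s => Z' s l),
    fun s => matOp_mem_graph hX' S s, fun l s => matOp_mem_graph (hY' l) S s,
    fun l s => matOp_mem_graph (fun t => hZ' t l) S s, ?_⟩
  have e1 : S * D.slash (V.T p) = D.slash p * S := by
    simp only [DiracMatrices.slash, Finset.mul_sum, Finset.sum_mul, smul_mul_assoc, ← hα,
      mul_smul_comm, Finset.smul_sum, hr, Complex.ofReal_sum, Finset.sum_smul, smul_smul]
    rw [Finset.sum_comm]
    refine Finset.sum_congr rfl fun l _ => Finset.sum_congr rfl fun j _ => ?_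
    push_cast
    rw [mul_comm]
  have e2 : S * (D.slash (V.T p) + (M : ℂ) • D.β) = (D.slash p + (M : ℂ) • D.β) * S := by
    rw [mul_add, add_mul, e1, mul_smul_comm, smul_mul_assoc, hβ]
  rw [map_sub, map_sub, map_sub, map_sub, map_add, map_add, map_smul, map_smul,
    matOp_vector_transform hα V.rotate hYr, matOp_vector_transform hα V.rotate hZr',
    fockUnitary_matOp, matOp_matOp, matOp_matOp, e2]

theorem hamiltonian_unitarilyEquivalent (hm : 0 ≤ m)
    (hf : ∀ j, IsFormFactor (photonEnergy m) (coupling ρ e j) (h j)) (V : PhotonRotation)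
    {S : Matrix (Fin 4) (Fin 4) ℂ} (hS : S.conjTranspose * S = 1) {r : Fin 3 → Fin 3 → ℝ}
    (hα : ∀ l, ∑ j, (r j l : ℂ) • (S * D.α j) = D.α l * S) (hβ : S * D.β = D.β * S)
    (hr : ∀ k j, V.T k j = ∑ l, r j l * k l)
    (hg : ∀ j, (fun x => ∑ l, (r j l : ℂ) * coupling ρ e l x)
      =ᵐ[photonMeasure] fun x => ∑ b, V.w x.1 x.2 b * coupling ρ e j (V.T x.1, b)) (p : R3) :
    UnitarilyEquivalent (hamiltonian D e ρ M q m (V.T p)) (hamiltonian D e ρ M q m p) := by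
  set W : SpinorFock ≃ₗᵢ[ℂ] SpinorFock := (fockUnitary V.rotate).trans (matUnitary S hS) with hW
  have hWap : ∀ Ψ, W Ψ = matOp S (fockUnitary V.rotate Ψ) := fun _ => rfl
  have fwd : ∀ Ψ Φ, (Ψ, Φ) ∈ (hamiltonian D e ρ M q m (V.T p)).graph →
      (W Ψ, W Φ) ∈ (hamiltonian D e ρ M q m p).graph := fun Ψ Φ hΨ =>
    rotate_hamiltonian_graph hm hf V hα hβ hr hg hΨ
  refine ⟨W, fun Ψ Φ => ⟨fwd Ψ Φ, fun hΨ => ?_⟩⟩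
  -- For the converse only the photon energy has to be rotated back, since it alone determines the
  -- domain. The value at `Ψ` then follows from the forward direction and injectivity of `W`.
  obtain ⟨X, _, _, hX, -, -, -⟩ := mem_hamiltonian_graph.1 hΨ
  have hω : ∀ k (a b : Fin 2), photonEnergy m (V.inv.T k, b) = photonEnergy m (k, a) :=
    fun k a b => by simp [photonEnergy, PhotonRotation.inv]
  have hdom : ∀ s, Ψ s ∈ (secondQuant (photonEnergy m)).domain := by
    intro s
    have h1 := V.inv.rotate_secondQuant hω (matOp_mem_graph hX S.conjTranspose s)
    have h2 : V.inv.rotate (matOp S.conjTranspose (W Ψ) s) = Ψ s := by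
      rw [hWap, matOp_matOp, hS, matOp_one, fockUnitary_apply, ← V.rotate_symm,
        LinearIsometryEquiv.symm_apply_apply]
    rw [h2] at h1
    exact LinearPMap.mem_domain_of_mem_graph h1
  obtain ⟨Φ', hΦ'⟩ := exists_mem_hamiltonian_graph (D := D) (M := M) (q := q) hm hf (V.T p) hdom
  have h3 := LinearPMap.mem_graph_snd_inj _ (fwd _ _ hΦ') hΨ rfl
  rwa [← W.injective h3]

end Rotation

/-! ### Polarization vectors and form factors -/

section Polarization

variable {e : Fin 2 → R3 → R3}

/-- At `k ≠ 0` the polarization vectors span the plane orthogonal to `k`. -/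
theorem IsPolarization.sum_inner_smul (he : IsPolarization e) {k : R3} (hk : k ≠ 0) {u : R3}
    (hu : inner ℝ u k = 0) : ∑ b, inner ℝ (e b k) u • e b k = u := by
  have hk' : ‖k‖ ≠ 0 := norm_ne_zero_iff.2 hk
  -- Adjoining `k/‖k‖` completes the frame to an orthonormal basis; its coefficient vanishes for `u
  -- ⟂ k`.
  set v : Fin 3 → R3 := Fin.cons (‖k‖⁻¹ • k) fun b => e b k with hv
  have hort := orthonormal_iff_ite.1 (he.orthonormal k)
  have hon : Orthonormal ℝ v := by
    rw [orthonormal_iff_ite]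
    intro i j
    refine Fin.cases ?_ (fun a => ?_) i <;> refine Fin.cases ?_ (fun b => ?_) j
    · simp only [hv, Fin.cons_zero, if_true, inner_smul_left, inner_smul_right,
        real_inner_self_eq_norm_sq, conj_trivial]
      field_simp
    · simp only [hv, Fin.cons_zero, Fin.cons_succ, inner_smul_left]
      rw [real_inner_comm, he.orthogonal, mul_zero, if_neg (Fin.succ_ne_zero b).symm]
    · simp only [hv, Fin.cons_zero, Fin.cons_succ, inner_smul_right, he.orthogonal, mul_zero]
      rw [if_neg (Fin.succ_ne_zero a)]
    · simp only [hv, Fin.cons_succ, hort, Fin.succ_inj]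
  have hspan : ⊤ ≤ Submodule.span ℝ (Set.range v) := by
    have h := (basisOfOrthonormalOfCardEqFinrank hon (by simp)).span_eq
    rw [coe_basisOfOrthonormalOfCardEqFinrank] at h
    exact h.ge
  have h := (OrthonormalBasis.mk hon hspan).sum_repr' u
  simp only [OrthonormalBasis.coe_mk] at h
  rw [Fin.sum_univ_succ] at h
  simpa [hv, inner_smul_left, real_inner_comm u k ▸ hu, hu] using h

theorem IsPolarization.abs_le_one (he : IsPolarization e) (b : Fin 2) (k : R3) (j : Fin 3) :
    |e b k j| ≤ 1 := by
  have h := PiLp.norm_apply_le (e b k) j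
  rwa [(he.orthonormal k).1 b] at h

theorem IsPolarization.measurable_apply (he : IsPolarization e) (j : Fin 3) :
    Measurable fun x : Photon => e x.2 x.1 j := by
  have : Measurable fun x : Photon => e x.2 x.1 :=
    measurable_from_prod_countable_left fun b => he.measurable b
  have hj : Measurable fun v : R3 => v j := by fun_prop
  exact hj.comp this

theorem lintegral_enorm_sq_ne_top {f : Photon → ℂ} (hf : MemLp f 2 photonMeasure) :
    ∫⁻ x, ‖f x‖ₑ ^ 2 ∂photonMeasure ≠ ∞ := by
  have h := eLpNorm_nnreal_pow_eq_lintegral (f := f) (μ := photonMeasure) (p := 2) two_ne_zero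
  have h' : eLpNorm f 2 photonMeasure ^ 2 = ∫⁻ x, ‖f x‖ₑ ^ 2 ∂photonMeasure := by
    simpa using h
  rw [← h']
  exact ENNReal.pow_ne_top hf.2.ne

/-- With `h = |k|⁻¹ ρ e_j` one has `|g|² = |k| |h|² ≤ ω_m |h|²`. Square integrability of `g` follows
from `|k|^{-1/2} ≤ 1 + |k|⁻¹`. -/
theorem isFormFactor_coupling (he : IsPolarization e) {ρ : R3 → ℂ} (hρ : MemLp ρ 2 volume)
    (hρ' : MemLp (fun k => ((‖k‖⁻¹ : ℝ) : ℂ) * ρ k) 2 volume) {m : ℝ} (hm : 0 ≤ m) (j : Fin 3) :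
    IsFormFactor (photonEnergy m) (coupling ρ e j)
      fun x => ((‖x.1‖⁻¹ : ℝ) : ℂ) * ρ x.1 * ((e x.2 x.1 j : ℝ) : ℂ) := by
  have h1 : MemLp (fun x : Photon => ρ x.1) 2 photonMeasure := hρ.comp_fst _
  have h2 : MemLp (fun x : Photon => ((‖x.1‖⁻¹ : ℝ) : ℂ) * ρ x.1) 2 photonMeasure :=
    hρ'.comp_fst _
  have hej : Measurable fun x : Photon => ((e x.2 x.1 j : ℝ) : ℂ) :=
    Complex.measurable_ofReal.comp (he.measurable_apply j)
  have hg : AEStronglyMeasurable (coupling ρ e j) photonMeasure := by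
    refine AEStronglyMeasurable.mul (AEStronglyMeasurable.mul ?_ h1.1) hej.aestronglyMeasurable
    refine Measurable.aestronglyMeasurable ?_
    fun_prop
  have hh := h2.1.mul hej.aestronglyMeasurable
  have hge : ∀ x : Photon, ‖coupling ρ e j x‖
      = (Real.sqrt ‖x.1‖)⁻¹ * ‖ρ x.1‖ * |e x.2 x.1 j| := by
    intro x
    simp only [coupling, norm_mul, Complex.norm_real, Real.norm_eq_abs]
    rw [abs_of_nonneg (inv_nonneg.2 (Real.sqrt_nonneg _))]
  have hhe : ∀ x : Photon, ‖((‖x.1‖⁻¹ : ℝ) : ℂ) * ρ x.1 * ((e x.2 x.1 j : ℝ) : ℂ)‖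
      = ‖x.1‖⁻¹ * ‖ρ x.1‖ * |e x.2 x.1 j| := by
    intro x
    simp
  refine ⟨measurable_photonEnergy m, photonEnergy_nonneg hm, hg, hh, ?_, ?_, fun x => ?_⟩
  · refine lintegral_enorm_sq_ne_top ((h1.norm.add h2.norm).of_le hg (ae_of_all _ fun x => ?_))
    have h3 : (Real.sqrt ‖x.1‖)⁻¹ ≤ 1 + ‖x.1‖⁻¹ := by
      have h4 : ‖x.1‖⁻¹ = (Real.sqrt ‖x.1‖)⁻¹ ^ 2 := by
        rw [inv_pow, Real.sq_sqrt (norm_nonneg _)]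
      rw [h4]
      nlinarith [sq_nonneg ((Real.sqrt ‖x.1‖)⁻¹ - 1), sq_nonneg (Real.sqrt ‖x.1‖)⁻¹]
    have h5 : ‖x.1‖⁻¹ * ‖ρ x.1‖ = ‖((‖x.1‖⁻¹ : ℝ) : ℂ) * ρ x.1‖ := by simp
    rw [hge]
    simp only [Pi.add_apply]
    have h6 : 0 ≤ ‖ρ x.1‖ + ‖x.1‖⁻¹ * ‖ρ x.1‖ := by positivity
    rw [← h5, Real.norm_eq_abs, abs_of_nonneg h6]
    calc (Real.sqrt ‖x.1‖)⁻¹ * ‖ρ x.1‖ * |e x.2 x.1 j|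
        ≤ (1 + ‖x.1‖⁻¹) * ‖ρ x.1‖ * 1 := by
          gcongr
          exact he.abs_le_one _ _ _
      _ = _ := by ring
  · refine lintegral_enorm_sq_ne_top (h2.of_le hh (ae_of_all _ fun x => ?_))
    have h3 : ‖((‖x.1‖⁻¹ : ℝ) : ℂ) * ρ x.1‖ = ‖x.1‖⁻¹ * ‖ρ x.1‖ := by simp
    rw [h3]
    refine (hhe x).trans_le ?_
    exact mul_le_of_le_one_right (by positivity) (he.abs_le_one _ _ _)
  · rw [hge, hhe]
    calc ((Real.sqrt ‖x.1‖)⁻¹ * ‖ρ x.1‖ * |e x.2 x.1 j|) ^ 2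
        = ‖x.1‖ * (‖x.1‖⁻¹ * ‖ρ x.1‖ * |e x.2 x.1 j|) ^ 2 := by
          simp only [mul_pow, inv_pow, Real.sq_sqrt (norm_nonneg x.1)]
          rcases eq_or_ne ‖x.1‖ 0 with h0 | h0
          · simp [h0]
          · field_simp
      _ ≤ _ := by
          gcongr
          exact norm_le_photonEnergy hm x

/-- A rotation of momentum space acts on the one-photon space so that the components of the
coupling function transform like a vector. -/
theorem exists_photonRotation (he : IsPolarization e) {ρ : R3 → ℂ} (hρ : MemLp ρ 2 volume)
    (T : R3 ≃ₗᵢ[ℝ] R3) (hT : ∀ᵐ k, ‖ρ (T k)‖ = ‖ρ k‖) {r : Fin 3 → Fin 3 → ℝ}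
    (hr : ∀ k j, T k j = ∑ l, r j l * k l) :
    ∃ V : PhotonRotation, V.T = T ∧
      ∀ j, (fun x => ∑ l, (r j l : ℂ) * coupling ρ e l x)
        =ᵐ[photonMeasure] fun x => ∑ b, V.w x.1 x.2 b * coupling ρ e j (V.T x.1, b) := by
  classical
  obtain ⟨ρ', hρm, hρe⟩ := hρ.1
  have hρm := hρm.measurable
  -- The phase turning `ρ (T k)` into `ρ k`. The representative `ρ'` makes it measurable; where `ρ'`
  -- vanishes any unimodular value would do.
  set θ : R3 → ℂ := fun k => if ρ' k = 0 then 1 else ρ' k / ρ' (T k) with hθ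
  have hTm : Measurable T := T.continuous.measurable
  have hθm : Measurable θ :=
    Measurable.ite (hρm (measurableSet_singleton 0)) measurable_const (hρm.div (hρm.comp hTm))
  -- Up to the phase, the transition matrix from the frame at `T k` to the rotated frame `T e(k)`.
  set w₀ : R3 → Matrix (Fin 2) (Fin 2) ℂ := fun k =>
    Matrix.of fun a b => θ k * ((inner ℝ (e b (T k)) (T (e a k)) : ℝ) : ℂ) with hw₀
  have hw₀m : ∀ a b, Measurable fun k => w₀ k a b := by
    intro a b
    refine hθm.mul (Complex.measurable_ofReal.comp ?_)
    exact ((he.measurable b).comp hTm).inner (hTm.comp (he.measurable a))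
  have hset : MeasurableSet {k | (w₀ k).conjTranspose * w₀ k = 1} := by
    simp only [← Matrix.ext_iff, Set.ofPred_forall]
    refine MeasurableSet.iInter fun a => MeasurableSet.iInter fun b =>
      measurableSet_eq_fun ?_ measurable_const
    simp only [Matrix.mul_apply, Matrix.conjTranspose_apply]
    exact Finset.measurable_sum _ fun c _ =>
      (continuous_star.measurable.comp (hw₀m c a)).mul (hw₀m c b)
  let V : PhotonRotation :=
    { T := T
      -- `PhotonRotation` asks for unitarity at every `k`, while `w₀` is known to be unitary only
      -- almost everywhere (for instance, `k = 0` is excluded).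
      w := fun k => if (w₀ k).conjTranspose * w₀ k = 1 then w₀ k else 1
      measurable_w := fun a b => by
        have : (fun k => (if (w₀ k).conjTranspose * w₀ k = 1 then w₀ k else 1) a b)
            = fun k => if (w₀ k).conjTranspose * w₀ k = 1 then w₀ k a b
              else (1 : Matrix (Fin 2) (Fin 2) ℂ) a b := by
          funext k
          split_ifs <;> rfl
        rw [this]
        exact Measurable.ite hset (hw₀m a b) measurable_const
      conj_mul_w := fun k => by
        split_ifs with h
        · exact h
        · simp }
  refine ⟨V, rfl, fun j => ae_photonMeasure_of_forall ?_⟩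
  have hk0 : ∀ᵐ k : R3, k ≠ 0 := Measure.ae_ne volume 0
  filter_upwards [hk0, hT, hρe, T.measurePreserving.quasiMeasurePreserving.ae hρe]
    with k hk hTk h1 h2 a
  have hTk0 : T k ≠ 0 := by simpa using hk
  have hθρ : θ k * ρ (T k) = ρ k := by
    simp only [hθ]
    split_ifs with h0
    · have h3 : ρ k = 0 := by rw [h1, h0]
      have h4 : ρ (T k) = 0 := by rw [← norm_eq_zero, hTk, h3, norm_zero]
      rw [h3, h4, mul_zero]
    · have h3 : ρ (T k) ≠ 0 := by
        rw [← norm_ne_zero_iff, hTk, norm_ne_zero_iff, h1]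
        exact h0
      rw [← h1, ← h2, div_mul_cancel₀ _ h3]
  have hθn : star (θ k) * θ k = 1 := by
    have h3 : ‖θ k‖ = 1 := by
      simp only [hθ]
      split_ifs with h0
      · simp
      · have h4 : ‖ρ' k‖ ≠ 0 := norm_ne_zero_iff.2 h0
        rw [norm_div, ← h2, hTk, h1, div_self h4]
    rw [RCLike.star_def, Complex.conj_mul', h3]
    simp
  -- Parseval in the plane orthogonal to `k`: the vectors `T⁻¹ e(T k)` are orthonormal there and are
  -- expanded in the frame `e(k)`.
  have hunit : (w₀ k).conjTranspose * w₀ k = 1 := by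
    ext b c
    have hperp : ∀ b, inner ℝ (T.symm (e b (T k))) k = 0 := fun b => by
      rw [← T.inner_map_map, T.apply_symm_apply]
      exact he.orthogonal b _
    have h3 := congrArg (fun u => inner ℝ u (T.symm (e c (T k))))
      (he.sum_inner_smul hk (hperp b))
    have h4 : ∀ a b, inner ℝ (e a k) (T.symm (e b (T k))) = inner ℝ (e b (T k)) (T (e a k)) :=
      fun a b => by rw [← T.inner_map_map, T.apply_symm_apply, real_inner_comm]
    simp only [sum_inner, inner_smul_left, conj_trivial, LinearIsometryEquiv.inner_map_map, h4,
      orthonormal_iff_ite.1 (he.orthonormal (T k))] at h3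
    rw [Matrix.mul_apply, Matrix.one_apply]
    simp only [Matrix.conjTranspose_apply, hw₀, Matrix.of_apply, star_mul', RCLike.star_def,
      Complex.conj_ofReal]
    rw [RCLike.star_def] at hθn
    calc _ = ((starRingEnd ℂ) (θ k) * θ k) * ((∑ a, inner ℝ (e b (T k)) (T (e a k))
          * inner ℝ (e c (T k)) (T (e a k)) : ℝ) : ℂ) := by
          push_cast
          rw [Finset.mul_sum]
          exact Finset.sum_congr rfl fun a _ => by ring
      _ = _ := by
          rw [hθn, h3, one_mul]
          split_ifs <;> simp
  have hVw : V.w k = w₀ k := if_pos hunit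
  have hperp : inner ℝ (T (e a k)) (T k) = 0 := by
    rw [T.inner_map_map]
    exact he.orthogonal a k
  have h5 := congrArg (fun u : R3 => u j) (he.sum_inner_smul hTk0 hperp)
  have h6 : ∑ b, inner ℝ (e b (T k)) (T (e a k)) * e b (T k) j = T (e a k) j := by
    rw [← h5]
    simp [Fin.sum_univ_two]
  change ∑ l, (r j l : ℂ) * coupling ρ e l (k, a) = ∑ b, V.w k a b * coupling ρ e j (T k, b)
  rw [hVw]
  simp only [coupling, hw₀, Matrix.of_apply, LinearIsometryEquiv.norm_map]
  calc _ = (((Real.sqrt ‖k‖)⁻¹ : ℝ) : ℂ) * ρ k * ((∑ l, r j l * e a k l : ℝ) : ℂ) := by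
        push_cast
        rw [Finset.mul_sum]
        exact Finset.sum_congr rfl fun l _ => by ring
    _ = (((Real.sqrt ‖k‖)⁻¹ : ℝ) : ℂ) * (θ k * ρ (T k))
          * ((∑ b, inner ℝ (e b (T k)) (T (e a k)) * e b (T k) j : ℝ) : ℂ) := by
        rw [← hr, h6, hθρ]
    _ = _ := by
        push_cast
        rw [Finset.mul_sum]
        exact Finset.sum_congr rfl fun l _ => by ring

end Polarization

/-! ### Half-turns of momentum space -/

section HalfTurns

/-- The half-turn around the axis `v`. -/
abbrev halfTurnMap (v : R3) : R3 ≃ₗᵢ[ℝ] R3 := (Submodule.span ℝ {v}).reflection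

theorem halfTurnMap_apply {v : R3} (hv : ‖v‖ = 1) (k : R3) :
    halfTurnMap v k = (2 * inner ℝ v k) • v - k := by
  rw [halfTurnMap, Submodule.reflection_singleton_apply, hv]
  simp [two_mul, two_smul, add_smul]

/-- The map is `-1` on the plane orthogonal to the axis, whose dimension is even; so half-turns
belong to `SO(3)`. -/
theorem det_halfTurnMap {v : R3} (hv : ‖v‖ = 1) :
    LinearMap.det ((halfTurnMap v).toLinearEquiv : R3 →ₗ[ℝ] R3) = 1 := by
  have : Fact (Module.finrank ℝ R3 = 2 + 1) := ⟨by simp⟩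
  have h0 : v ≠ 0 := by
    rintro rfl
    simp at hv
  have h := Submodule.det_reflection (K := Submodule.span ℝ {v})
  rw [Submodule.finrank_orthogonal_span_singleton (n := 2) h0] at h
  rw [neg_one_sq] at h
  exact h

/-- Vectors of equal length are related by a half-turn. -/
theorem exists_halfTurnMap {e : Fin 2 → R3 → R3} (he : IsPolarization e) {p p' : R3}
    (h : ‖p‖ = ‖p'‖) : ∃ v : R3, ‖v‖ = 1 ∧ halfTurnMap v p' = p := by
  by_cases h0 : p + p' = 0
  -- For opposite vectors any axis orthogonal to `p'` works, and a polarization vector at `p'` is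
  -- one, even if `p' = 0`. Otherwise the axis is the bisector `p + p'`.
  · refine ⟨e 0 p', (he.orthonormal p').1 0, ?_⟩
    rw [halfTurnMap_apply ((he.orthonormal p').1 0), he.orthogonal, mul_zero, zero_smul, zero_sub,
      neg_eq_of_add_eq_zero_left h0]
  · have hn : ‖p + p'‖ ≠ 0 := norm_ne_zero_iff.2 h0
    refine ⟨‖p + p'‖⁻¹ • (p + p'), by rw [norm_smul, norm_inv, norm_norm, inv_mul_cancel₀ hn], ?_⟩
    rw [halfTurnMap_apply (by rw [norm_smul, norm_inv, norm_norm, inv_mul_cancel₀ hn]),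
      inner_smul_left, smul_smul, inner_add_left, real_inner_self_eq_norm_sq]
    have h1 : 2 * (inner ℝ p p' + ‖p'‖ ^ 2) = ‖p + p'‖ ^ 2 := by
      rw [norm_add_sq_real, h]
      ring
    have h2 : 2 * ((starRingEnd ℝ) ‖p + p'‖⁻¹ * (inner ℝ p p' + ‖p'‖ ^ 2)) * ‖p + p'‖⁻¹ = 1 := by
      rw [conj_trivial]
      calc _ = (2 * (inner ℝ p p' + ‖p'‖ ^ 2)) * (‖p + p'‖⁻¹) ^ 2 := by ring
        _ = 1 := by rw [h1, inv_pow, mul_inv_cancel₀ (pow_ne_zero 2 hn)]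
    rw [h2, one_smul, add_sub_cancel_right]

theorem halfTurnMap_coord {v : R3} (hv : ‖v‖ = 1) (k : R3) (j : Fin 3) :
    halfTurnMap v k j = ∑ l, (2 * v j * v l - if j = l then 1 else 0) * k l := by
  rw [halfTurnMap_apply hv]
  simp only [PiLp.sub_apply, PiLp.smul_apply, smul_eq_mul, sub_mul, Finset.sum_sub_distrib, ite_mul,
    one_mul, zero_mul, Finset.sum_ite_eq, Finset.mem_univ, if_true]
  congr 1
  simp only [PiLp.inner_apply, RCLike.inner_apply, conj_trivial, Finset.mul_sum, Finset.sum_mul]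
  exact Finset.sum_congr rfl fun l _ => by ring

theorem DiracMatrices.sum_smul_halfTurn_mul (D : DiracMatrices) {v : R3} (hv : ‖v‖ = 1)
    (l : Fin 3) :
    ∑ j, (((2 * v j * v l - if j = l then 1 else 0 : ℝ)) : ℂ) • (D.halfTurn v * D.α j)
      = D.α l * D.halfTurn v := by
  rw [D.α_mul_halfTurn hv]
  simp only [Complex.ofReal_sub, sub_smul, Finset.sum_sub_distrib]
  congr 1
  · simp only [DiracMatrices.slash, Finset.mul_sum, Finset.smul_sum, mul_smul_comm, smul_smul]
    refine Finset.sum_congr rfl fun j _ => ?_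
    push_cast
    ring_nf
  · simp [apply_ite]

end HalfTurns

/-! ### Unitary equivalence and monotonicity of the lowest energy -/

section Main

variable {D : DiracMatrices} {e : Fin 2 → R3 → R3} {ρ : R3 → ℂ} {M q m : ℝ}

theorem unitarilyEquivalent_closure_of_norm_eq (he : IsPolarization e) (hρ : MemLp ρ 2 volume)
    (hρ' : MemLp (fun k => ((‖k‖⁻¹ : ℝ) : ℂ) * ρ k) 2 volume)
    (hrot : RotationInvariant fun k => ‖ρ k‖) (hm : 0 ≤ m) {p p' : R3} (h : ‖p‖ = ‖p'‖) :
    UnitarilyEquivalent (hamiltonian D e ρ M q m p).closure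
      (hamiltonian D e ρ M q m p').closure := by
  obtain ⟨v, hv, rfl⟩ := exists_halfTurnMap he h
  obtain ⟨V, hVT, hg⟩ := exists_photonRotation he hρ (halfTurnMap v)
    (hrot _ (det_halfTurnMap hv)) (halfTurnMap_coord hv)
  rw [← hVT]
  exact (hamiltonian_unitarilyEquivalent hm (isFormFactor_coupling he hρ hρ' hm) V
    (D.conjTranspose_halfTurn_mul hv) (D.sum_smul_halfTurn_mul hv) (D.halfTurn_mul_β v)
    (by rw [hVT]; exact halfTurnMap_coord hv) hg p').closure

/-- Infima in the extended reals are compared through real thresholds `c`. If the energy at `p'` is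
`-∞` there is nothing to show. -/
theorem lowestEnergy_le_of_forall {p p' : R3}
    (h : ∀ c : ℝ, (∀ t : ℝ, t < c → InResolventSet (hamiltonian D e ρ M q m p').closure t) →
      ∀ t : ℝ, t < c → InResolventSet (hamiltonian D e ρ M q m p).closure t) :
    lowestEnergy D e ρ M q m p' ≤ lowestEnergy D e ρ M q m p := by
  refine le_sInf ?_
  rintro _ ⟨t, ht, rfl⟩
  by_contra! hlt
  obtain ⟨c, htc, hc⟩ := EReal.lt_iff_exists_real_btwn.1 hlt
  refine ht (h c (fun s hs => ?_) t (EReal.coe_lt_coe_iff.1 htc))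
  by_contra hs'
  have h1 : lowestEnergy D e ρ M q m p' ≤ (s : EReal) := sInf_le ⟨s, hs', rfl⟩
  exact absurd (EReal.coe_lt_coe_iff.2 hs) (not_lt.2 (hc.le.trans h1))

theorem closure_hamiltonian_graph_shift (p p' : R3) (Ψ Φ : SpinorFock) :
    (Ψ, Φ) ∈ (hamiltonian D e ρ M q m p).closure.graph ↔
      (Ψ, Φ + matCLM (D.slash (p' - p)) Ψ) ∈ (hamiltonian D e ρ M q m p').closure.graph :=
  closure_graph_iff_of_graph_iff (ContinuousLinearEquiv.refl ℂ SpinorFock)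
    (matCLM (D.slash (p' - p))) (hamiltonian_graph_shift p p') Ψ Φ

/-- A vector of length at most `‖p'‖` is a convex combination of two antipodal vectors of
length `‖p'‖`. -/
theorem exists_convex_antipodal {p p' : R3} (h : ‖p‖ ≤ ‖p'‖) :
    ∃ (u : R3) (s : ℝ), ‖u‖ = ‖p'‖ ∧ 0 ≤ s ∧ s ≤ 1 ∧ p = s • u + (1 - s) • (-u) := by
  rcases eq_or_ne p 0 with rfl | hp
  · exact ⟨p', 1 / 2, rfl, by norm_num, by norm_num, by module⟩
  have hn : 0 < ‖p‖ := norm_pos_iff.2 hp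
  have hn' : 0 < ‖p'‖ := hn.trans_le h
  have hq : ‖p‖ / ‖p'‖ ≤ 1 := div_le_one_of_le₀ h hn'.le
  have hq0 : 0 ≤ ‖p‖ / ‖p'‖ := by positivity
  -- The weight solves `s - (1 - s) = ‖p‖ / ‖p'‖`.
  refine ⟨(‖p'‖ / ‖p‖) • p, (1 + ‖p‖ / ‖p'‖) / 2, ?_, by linarith, by linarith, ?_⟩
  · rw [norm_smul, Real.norm_eq_abs, abs_of_nonneg (by positivity), div_mul_cancel₀ _ hn.ne']
  · rw [← smul_neg, smul_neg, smul_smul, smul_neg, smul_smul, ← sub_eq_add_neg, ← sub_smul]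
    have : (1 + ‖p‖ / ‖p'‖) / 2 * (‖p'‖ / ‖p‖) - (1 - (1 + ‖p‖ / ‖p'‖) / 2) * (‖p'‖ / ‖p‖) = 1 := by
      field_simp
      ring
    rw [this, one_smul]

/-- For fixed `Ψ` the form is affine in the momentum, so the average of the two bounds with weights
`s` and `1 - s` is the bound at `p`. -/
theorem re_inner_shift_convex {Ψ Φ : SpinorFock} {c s : ℝ} (hs : 0 ≤ s) (hs1 : s ≤ 1) {p u u' : R3}
    (hp : p = s • u + (1 - s) • u')
    (h1 : c * ‖Ψ‖ ^ 2 ≤ (inner ℂ Ψ (Φ + matCLM (D.slash (u - p)) Ψ)).re)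
    (h2 : c * ‖Ψ‖ ^ 2 ≤ (inner ℂ Ψ (Φ + matCLM (D.slash (u' - p)) Ψ)).re) :
    c * ‖Ψ‖ ^ 2 ≤ (inner ℂ Ψ Φ).re := by
  have hlin : ∀ v : R3, (inner ℂ Ψ (Φ + matCLM (D.slash v) Ψ)).re
      = (inner ℂ Ψ Φ).re + ∑ j, v j * (inner ℂ Ψ (matOp (D.α j) Ψ)).re := by
    intro v
    rw [inner_add_right, Complex.add_re, matCLM_apply, DiracMatrices.slash, matOp_sum, inner_sum,
      Complex.re_sum]
    congr 1
    refine Finset.sum_congr rfl fun j _ => ?_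
    rw [matOp_smul, inner_smul_right, Complex.re_ofReal_mul]
  rw [hlin] at h1 h2
  have h3 : s * (∑ j, (u - p) j * (inner ℂ Ψ (matOp (D.α j) Ψ)).re)
      + (1 - s) * (∑ j, (u' - p) j * (inner ℂ Ψ (matOp (D.α j) Ψ)).re) = 0 := by
    rw [Finset.mul_sum, Finset.mul_sum, ← Finset.sum_add_distrib]
    refine Finset.sum_eq_zero fun j _ => ?_
    rw [hp]
    simp only [PiLp.sub_apply, PiLp.add_apply, PiLp.smul_apply, smul_eq_mul]
    ring
  have h4 := mul_le_mul_of_nonneg_left h1 hs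
  have h5 := mul_le_mul_of_nonneg_left h2 (sub_nonneg.2 hs1)
  linarith

theorem lowestEnergy_le_of_norm_le (he : IsPolarization e) (hρ : MemLp ρ 2 volume)
    (hρ' : MemLp (fun k => ((‖k‖⁻¹ : ℝ) : ℂ) * ρ k) 2 volume)
    (hrot : RotationInvariant fun k => ‖ρ k‖) (hm : 0 ≤ m) {p p' : R3} (h : ‖p‖ ≤ ‖p'‖) :
    lowestEnergy D e ρ M q m p' ≤ lowestEnergy D e ρ M q m p := by
  refine lowestEnergy_le_of_forall fun c hc t ht => ?_
  obtain ⟨u, s, hu, hs, hs1, hp⟩ := exists_convex_antipodal h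
  have hsymm : ∀ p, IsSymmetricOp (hamiltonian D e ρ M q m p).closure := fun p =>
    (hamiltonian_symm (isFormFactor_coupling he hρ hρ' hm) p).closure
  have hres : ∀ v : R3, ‖v‖ = ‖p'‖ → ∀ t : ℝ, t < c →
      InResolventSet (hamiltonian D e ρ M q m v).closure t := fun v hv t ht =>
    (unitarilyEquivalent_closure_of_norm_eq he hρ hρ' hrot hm hv.symm).inResolventSet (hc t ht)
  -- Resolvents exist at `u` by covariance, and `p` is reached by the bounded matrix `α·(p - u)`.
  -- The antipode `-u` enters only through its form bound.
  refine inResolventSet_of_perturbation (hsymm u) (hres u hu) (matCLM (D.slash (p - u)))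
    (closure_hamiltonian_graph_shift u p) (fun Ψ Φ hΨ => ?_) ht
  exact re_inner_shift_convex hs hs1 hp
    (le_re_inner_of_forall_inResolventSet (hsymm u) (hres u hu)
      ((closure_hamiltonian_graph_shift p u Ψ Φ).1 hΨ))
    (le_re_inner_of_forall_inResolventSet (hsymm (-u)) (hres (-u) (by rw [norm_neg, hu]))
      ((closure_hamiltonian_graph_shift p (-u) Ψ Φ).1 hΨ))

end Main

end DiracPolaron

end

theorem propositionP1p8
    (D : DiracPolaron.DiracMatrices)
    (e : Fin 2 → DiracPolaron.R3 → DiracPolaron.R3) (he : DiracPolaron.IsPolarization e)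
    (ρ : DiracPolaron.R3 → ℂ) (hρ : MemLp ρ 2 volume)
    (hρ' : MemLp (fun k => ((‖k‖⁻¹ : ℝ) : ℂ) * ρ k) 2 volume)
    (hrot : DiracPolaron.RotationInvariant fun k => ‖ρ k‖)
    (M q m : ℝ) (hm : 0 ≤ m) :
    (∀ p p' : DiracPolaron.R3, ‖p‖ = ‖p'‖ →
      DiracPolaron.UnitarilyEquivalent
        (DiracPolaron.hamiltonian D e ρ M q m p).closure
        (DiracPolaron.hamiltonian D e ρ M q m p').closure) ∧
    (∀ p p' : DiracPolaron.R3, ‖p‖ = ‖p'‖ →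
      DiracPolaron.lowestEnergy D e ρ M q m p = DiracPolaron.lowestEnergy D e ρ M q m p') ∧
    (∀ p p' : DiracPolaron.R3, ‖p‖ ≤ ‖p'‖ →
      DiracPolaron.lowestEnergy D e ρ M q m p' ≤ DiracPolaron.lowestEnergy D e ρ M q m p) := by
  refine ⟨fun p p' h =>
    DiracPolaron.unitarilyEquivalent_closure_of_norm_eq he hρ hρ' hrot hm h, fun p p' h => ?_,
    fun p p' h => DiracPolaron.lowestEnergy_le_of_norm_le he hρ hρ' hrot hm h⟩
  rw [DiracPolaron.lowestEnergy, DiracPolaron.lowestEnergy,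
    (DiracPolaron.unitarilyEquivalent_closure_of_norm_eq he hρ hρ' hrot hm h).opSpectrum_eq]
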